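/- **Setting.** Let $\dot x=[J(x)-R(x)]\nabla H(x)+G(x)u$ be a port-Hamiltonian system on $\mathbb R^n$ with $J$ skew-symmetric, $R$ symmetric positive semidefinite, both continuous, and $H$ smooth. Put $J_R=J-R$ and $f_\rho=J_R\nabla H$. Let $k_{\rm base}$ be a $C^2$ positive semidefinite kernel on $\mathbb R^n$ with RKHS $\mathcal H$, and $k_{\rm phs}(x,x')=\sigma_f^2J_R(x)\nabla_x\nabla_{x'}k_{\rm base}(x,x')J_R(x')^\top$, $\sigma_f>0$. Let $x:[0,\infty)\to\mathbb R^n$ be a $C^{p+1}$ trajectory under an input $u$, with bounded $(p+1)$-st derivative and with $\operatorname{tr}k_{\rm phs}(x(t),x(t))$ bounded in $t\ge0$. Fix $M\ge1$ and a variable-step linear multistep method $\sum_{j=0}^M a_j x(t_{k+j})=\sum_{j=0}^M b_j\dot x(t_{k+j})$ that is exact on polynomials of degree $\le p$ (order $p$); its coefficients are continuous functions of the $M$ positive steps of the window, $a_j$ being homogeneous of degree $0$ and $b_j$ of degree $1$. Stacking the windows $k=1,\dots,\ell:=K-M$ of a grid $t_1<\dots<t_K$ gives $A,B\in\mathbb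 R^{\ell\times K}$; put $A_I=A\otimes I_n$, $B_I=B\otimes I_n$. **Data.** For $K>M$, the sampling times $t_1,\dots,t_K$ are independent random variables (possibly deterministic) which almost surely satisfy $0\le t_1<\dots<t_K$, $h_k:=t_{k+1}-t_k\le h_{\max}$ and $\omega^{-1}\le h_{k+1}/h_k\le\omega$. One observes $\tilde x_k=x(t_k)+\varepsilon_k$ with $\varepsilon_k\sim\mathcal N(0,\sigma_x^2I_n)$ i.i.d. and independent of the times. Let $X=(x(t_k))_k$, $U=(u(t_k))_k$, $Y=A_I\tilde X$, $K_Y=B_Ik_{\rm phs}(X,X)B_I^\top$, $k_Y(z)=B_Ik_{\rm phs}(X,z)$. With regularization $\lambda=\lambda_0\ell^{-1/5}$, $\lambda_0>0$ fixed, the Tikhonov (Gaussian process) estimator is $$\widehat f(z)=k_Y(z)^\top\,(K_Y+\ell\lambda I)^{-1}\,\bigl(Y-B_IG(X)U\bigr).$$ **Norms.** Let $\nu$ be a measure on $\mathbb R^n$ with $\int\operatorname{tr}k_{\rm phs}(z,z)\,d\nu(z)<\infty$. Put $\|v\|_{\mathcal V}^2=\int\|v\|^2d\nu$ and $\|Bv\|_{\mathcal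 W}^2=\frac1\ell\sum_{k=1}^{\ell}\mathbb E\bigl\|\sum_iB_{ki}v(x(t_i))\bigr\|^2$, and $\mathbb E[h^{2p+2}]=\frac1\ell\sum_{k=1}^{\ell}\mathbb E[h_k^{2p+2}]$. Let $c^*$ be the largest $c\ge0$ such that $c\,\|v\|_{\mathcal V}\le\|Bv\|_{\mathcal W}$ for all $v=J_R\nabla g$, $g\in\mathcal H$ (if there is no largest one, put $c^*=0$). **Proposition.** Assume $H\in\mathcal H$. There are constants $C_{\rm fit},C_{\rm bias}\in(0,\infty)$, depending only on the system, the trajectory, the kernel, the method, $p,h_{\max},\omega,\sigma_x,\lambda_0$ (not on $K$, $\ell$, the distribution of the sampling times, $\nu$ or $\eta$), such that for all $K>M$, all sampling times as above and all $\nu$ there is a finite constant $c_{\rm obs}(h)>0$, equal to the observability constant $c^*$ whenever $c^*>0$, such that for every $0<\eta\le1$, with probability at least $1-\eta$, $$\|\widehat f-f_\rho\|_{\mathcal V}^2\le\frac{C_{\rm fit}}{c_{\rm obs}^2(h)}\log\frac4\eta\;\ell^{-1/5}+\frac{C_{\rm bias}}{c_{\rm obs}^2(h)}\,\mathbb E[h^{2p+2}].$$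 -/

import Mathlib

open MeasureTheory ProbabilityTheory
open scoped NNReal ENNReal Matrix Kronecker Gradient

noncomputable section

namespace MSPHS

/-- The state space `ℝⁿ` with its Euclidean norm. -/
abbrev State (n : ℕ) := EuclideanSpace ℝ (Fin n)

/-- A port-Hamiltonian system `ẋ = [J(x) - R(x)] ∇H(x) + G(x) u`. -/
structure PortHamiltonian (n m : ℕ) where
  J : State n → Matrix (Fin n) (Fin n) ℝ
  R : State n → Matrix (Fin n) (Fin n) ℝ
  G : State n → Matrix (Fin n) (Fin m) ℝ
  H : State n → ℝ
  J_skew : ∀ x, (J x)ᵀ = -J x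
  R_posSemidef : ∀ x, (R x).PosSemidef
  J_cont : Continuous J
  R_cont : Continuous R
  H_smooth : ContDiff ℝ ((⊤ : ℕ∞) : WithTop ℕ∞) H

namespace PortHamiltonian

variable {n m : ℕ} (S : PortHamiltonian n m)

/-- `J_R(x) = J(x) - R(x)`. -/
def JR (x : State n) : Matrix (Fin n) (Fin n) ℝ := S.J x - S.R x

/-- The vector field `x ↦ J_R(x) ∇g(x)` generated by an energy function `g`. -/
def field (g : State n → ℝ) (x : State n) : State n :=
  WithLp.toLp 2 (S.JR x *ᵥ (∇ g x).ofLp)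

/-- The true zero-input drift `f(x) = J_R(x) ∇H(x)`. -/
def drift : State n → State n := S.field S.H

/-- The input part `G(x) u`. -/
def port (x : State n) (u : Fin m → ℝ) : State n := WithLp.toLp 2 (S.G x *ᵥ u)

/-- `x` is a trajectory on `[0, ∞)` under the input signal `u`. -/
def IsTrajectory (u : ℝ → Fin m → ℝ) (x : ℝ → State n) : Prop :=
  ∀ t, 0 ≤ t → HasDerivWithinAt x (S.drift (x t) + S.port (x t) (u t)) (Set.Ici 0) t

end PortHamiltonian

/-! ### Base kernel and port-Hamiltonian kernel -/

/-- The (scalar) reproducing kernel of a Hilbert space `𝓗` of functions on `ℝⁿ`. -/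
def baseKernel {n : ℕ} (𝓗 : Type*) [NormedAddCommGroup 𝓗] [InnerProductSpace ℝ 𝓗]
    [CompleteSpace 𝓗] [RKHS ℝ 𝓗 (State n) ℝ] (x y : State n) : ℝ :=
  RKHS.kernel 𝓗 x y 1

/-- The matrix `∇ₓ ∇ₓ' k(x, x')` with entries `∂_{x_i} ∂_{x'_j} k(x, x')`. -/
def mixedHessian {n : ℕ} (k : State n → State n → ℝ) (x y : State n) :
    Matrix (Fin n) (Fin n) ℝ :=
  Matrix.of fun i j =>
    fderiv ℝ (fun x' => fderiv ℝ (fun y' => k x' y') y (EuclideanSpace.single j 1)) x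
      (EuclideanSpace.single i 1)

/-- `k_phs(x, x') = σ_f² J_R(x) ∇ₓ∇ₓ' k(x, x') J_R(x')ᵀ`. -/
def phsKernel {n m : ℕ} (S : PortHamiltonian n m) (k : State n → State n → ℝ) (σf : ℝ)
    (x y : State n) : Matrix (Fin n) (Fin n) ℝ :=
  σf ^ 2 • (S.JR x * mixedHessian k x y * (S.JR y)ᵀ)

/-! ### Variable-step linear multistep methods -/

/-- A variable-step linear multistep method on windows of `M + 1` nodes,
`∑ⱼ aⱼ x(tⱼ) = ∑ⱼ bⱼ ẋ(tⱼ)`. The coefficients are functions of the `M` step sizes in the window,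
continuous for positive steps. The `aⱼ` and `bⱼ / h` depend on the ratios of the steps only. -/
structure VLMM (M : ℕ) where
  a : (Fin M → ℝ) → Fin (M + 1) → ℝ
  b : (Fin M → ℝ) → Fin (M + 1) → ℝ
  a_scale : ∀ (s : ℝ) (h : Fin M → ℝ), 0 < s → (∀ i, 0 < h i) → a (s • h) = a h
  b_scale : ∀ (s : ℝ) (h : Fin M → ℝ), 0 < s → (∀ i, 0 < h i) → b (s • h) = s • b h
  a_cont : ContinuousOn a {h | ∀ i, 0 < h i}
  b_cont : ContinuousOn b {h | ∀ i, 0 < h i}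

/-- Position of node `j` in a window with steps `h`, the first node being at `0`. -/
def nodeOffset {M : ℕ} (h : Fin M → ℝ) (j : Fin (M + 1)) : ℝ :=
  ∑ i : Fin M, if i.castSucc < j then h i else 0

/-- Consistency of order `p`: the method is exact on polynomials of degree at most `p`. -/
def VLMM.HasOrder {M : ℕ} (meth : VLMM M) (p : ℕ) : Prop :=
  ∀ h : Fin M → ℝ, (∀ i, 0 < h i) → ∀ q : Polynomial ℝ, q.natDegree ≤ p →
    ∑ j, meth.a h j * q.eval (nodeOffset h j) =
      ∑ j, meth.b h j * q.derivative.eval (nodeOffset h j)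

section Grid

variable {K M : ℕ}

/-- Index in the grid of node `j` of window `k`. -/
def winNode (k : Fin (K - M)) (j : Fin (M + 1)) : Fin K :=
  ⟨k.1 + j.1, by have := k.2; have := j.2; omega⟩

/-- The step sizes inside window `k`. -/
def winSteps (t : Fin K → ℝ) (k : Fin (K - M)) (i : Fin M) : ℝ :=
  t (winNode k i.succ) - t (winNode k i.castSucc)

/-- `h_k = t_{k+1} - t_k`. -/
def step [NeZero M] (t : Fin K → ℝ) (k : Fin (K - M)) : ℝ := winSteps t k (0 : Fin M)

/-- Grids of non-negative, strictly increasing times with steps at most `hmax` and ratios of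
consecutive steps in `[1/ω, ω]`. -/
structure AdmissibleGrid (hmax ω : ℝ) (t : Fin K → ℝ) : Prop where
  nonneg : ∀ i, 0 ≤ t i
  step_pos : ∀ i j : Fin K, i.1 + 1 = j.1 → t i < t j
  step_le : ∀ i j : Fin K, i.1 + 1 = j.1 → t j - t i ≤ hmax
  ratio : ∀ i j l : Fin K, i.1 + 1 = j.1 → j.1 + 1 = l.1 →
    t l - t j ≤ ω * (t j - t i) ∧ t j - t i ≤ ω * (t l - t j)

/-- The coefficient matrix `A ∈ ℝ^{(K-M)×K}`. -/
def matA (meth : VLMM M) (t : Fin K → ℝ) : Matrix (Fin (K - M)) (Fin K) ℝ :=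
  Matrix.of fun k i => ∑ j, if winNode k j = i then meth.a (winSteps t k) j else 0

/-- The coefficient matrix `B ∈ ℝ^{(K-M)×K}`. -/
def matB (meth : VLMM M) (t : Fin K → ℝ) : Matrix (Fin (K - M)) (Fin K) ℝ :=
  Matrix.of fun k i => ∑ j, if winNode k j = i then meth.b (winSteps t k) j else 0

variable {n m : ℕ}

/-- `A_I = A ⊗ I_n`. -/
def matAI (n : ℕ) (meth : VLMM M) (t : Fin K → ℝ) :
    Matrix (Fin (K - M) × Fin n) (Fin K × Fin n) ℝ :=
  matA meth t ⊗ₖ (1 : Matrix (Fin n) (Fin n) ℝ)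

/-- `B_I = B ⊗ I_n`. -/
def matBI (n : ℕ) (meth : VLMM M) (t : Fin K → ℝ) :
    Matrix (Fin (K - M) × Fin n) (Fin K × Fin n) ℝ :=
  matB meth t ⊗ₖ (1 : Matrix (Fin n) (Fin n) ℝ)

/-! ### The estimator -/

/-- The labels `Y - B_I G(X)U` with `Y = A_I X̃`, `X̃ = X + ε`: `t` are the sampling times and
`ε` the measurement errors of the states. -/
def labels (S : PortHamiltonian n m) (meth : VLMM M) (u : ℝ → Fin m → ℝ) (x : ℝ → State n)
    (t : Fin K → ℝ) (ε : Fin K × Fin n → ℝ) : Fin (K - M) × Fin n → ℝ :=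
  matAI n meth t *ᵥ (fun q => x (t q.1) q.2 + ε q)
    - matBI n meth t *ᵥ (fun q => S.port (x (t q.1)) (u (t q.1)) q.2)

/-- `K_Y = B_I K_phs B_Iᵀ`. -/
def gramY (kphs : State n → State n → Matrix (Fin n) (Fin n) ℝ) (meth : VLMM M)
    (x : ℝ → State n) (t : Fin K → ℝ) :
    Matrix (Fin (K - M) × Fin n) (Fin (K - M) × Fin n) ℝ :=
  matBI n meth t *
    (Matrix.of fun q r : Fin K × Fin n => kphs (x (t q.1)) (x (t r.1)) q.2 r.2) *
    (matBI n meth t)ᵀ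

/-- `k_Y(z) = B_I k_phs(X, z)`. -/
def crossY (kphs : State n → State n → Matrix (Fin n) (Fin n) ℝ) (meth : VLMM M)
    (x : ℝ → State n) (t : Fin K → ℝ) (z : State n) :
    Matrix (Fin (K - M) × Fin n) (Fin n) ℝ :=
  matBI n meth t * (Matrix.of fun (q : Fin K × Fin n) (c : Fin n) => kphs (x (t q.1)) z q.2 c)

/-- The Tikhonov-regularized (Gaussian process posterior mean) vector field
`f̂(z) = k_Y(z)ᵀ (K_Y + ℓ reg I)⁻¹ (Y - B_I G(X)U)`, where `ℓ = K - M` and `reg > 0` is the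
regularization parameter. -/
def estimator (S : PortHamiltonian n m)
    (kphs : State n → State n → Matrix (Fin n) (Fin n) ℝ) (meth : VLMM M)
    (u : ℝ → Fin m → ℝ) (x : ℝ → State n) (reg : ℝ)
    (t : Fin K → ℝ) (ε : Fin K × Fin n → ℝ) (z : State n) : State n :=
  WithLp.toLp 2 ((crossY kphs meth x t z)ᵀ *ᵥ
    ((gramY kphs meth x t + (((K - M : ℕ) : ℝ) * reg) • 1)⁻¹ *ᵥ labels S meth u x t ε))

end Grid

/-! ### Norms, observability constant and mean step size -/

/-- `‖v‖²_𝓥`, where `𝓥 = L²(ν; ℝⁿ)`. -/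
def vNormSq {n : ℕ} (ν : Measure (State n)) (v : State n → State n) : ℝ :=
  ∫ z, ‖v z‖ ^ 2 ∂ν

section Random

variable {n m K M : ℕ} {Ω : Type*} [MeasurableSpace Ω]

/-- `‖B v‖²_𝓦`: the expected mean over the `K - M` windows of the squared norm of the multistep
combination of the values of `v` along the sampled trajectory. -/
def wNormSq (P : Measure Ω) (meth : VLMM M) (x : ℝ → State n) (t : Fin K → Ω → ℝ)
    (v : State n → State n) : ℝ :=
  (∑ k : Fin (K - M), ∫ w, ‖∑ i, matB meth (fun i => t i w) k i • v (x (t i w))‖ ^ 2 ∂P) /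
    ((K - M : ℕ) : ℝ)

/-- The observability constant `c_obs(h)` of the discretization: the largest `c` with
`c ‖v‖_𝓥 ≤ ‖B v‖_𝓦` for all fields `v = J_R ∇g`, `g` in the base RKHS `𝓗`.
(If every `c` has this property, the value is `0`.) -/
def obsConst (𝓗 : Type*) [NormedAddCommGroup 𝓗] [InnerProductSpace ℝ 𝓗]
    [RKHS ℝ 𝓗 (State n) ℝ] (S : PortHamiltonian n m) (P : Measure Ω) (meth : VLMM M)
    (x : ℝ → State n) (t : Fin K → Ω → ℝ) (ν : Measure (State n)) : ℝ :=
  sSup {c : ℝ | 0 ≤ c ∧ ∀ g : 𝓗,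
    c ^ 2 * vNormSq ν (S.field (g : State n → ℝ)) ≤
      wNormSq P meth x t (S.field (g : State n → ℝ))}

/-- `𝔼[h^q]`, the expectation being over the random grid and a uniformly chosen window. -/
def meanStepPow [NeZero M] (P : Measure Ω) (t : Fin K → Ω → ℝ) (q : ℕ) : ℝ :=
  (∑ k : Fin (K - M), ∫ w, step (fun i => t i w) k ^ q ∂P) / ((K - M : ℕ) : ℝ)

/-- The random data: sampling times forming almost surely an admissible grid, and measurement errors
`N(0, σx²)`. All times and all coordinates of all errors are independent. -/
structure IsSample (P : Measure Ω) (hmax ω : ℝ) (σx2 : ℝ≥0)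
    (t : Fin K → Ω → ℝ) (ε : Fin K × Fin n → Ω → ℝ) : Prop where
  measurable_t : ∀ i, Measurable (t i)
  admissible : ∀ᵐ w ∂P, AdmissibleGrid hmax ω (fun i => t i w)
  gaussian : ∀ q, HasLaw (ε q) (gaussianReal 0 σx2) P
  indep : iIndepFun (Sum.elim t ε) P

end Random

end MSPHS

end

/-! Everything takes place in the base RKHS. Because the kernel is `C²`, the feature map `Φ z = k(z,
·)` is differentiable (`differentiable_of_contDiff_inner`), so each component of `J_R ∇g` at a point
is the inner product of `g` with a vector `fieldRep`, and the port-Hamiltonian kernel is `σf²` times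
the Gram kernel of these vectors. The estimator is therefore the field of an element `g` solving
ridge-regularized normal equations whose regressors `gridRep` are the multistep combinations of such
vectors (`exists_estimator_eq_field`). The labels equal the exact values for the true energy `g₀`
plus a truncation error, of order `h^(p+1)` by Taylor expansion, plus the filtered measurement noise
(`labels_eq`).

Testing the normal equations with `d = g - g₀` bounds the empirical sum of squares of `d` and `‖d‖²`
by regularization, noise and truncation terms (`regularized_error_bound`). Three random quantities
remain: the noise vector, the deviation of the empirical covariance from its mean, and the deviation
of the sum of `h^(2p+2)` from its mean. Their norms are of order `√ℓ` with high probability,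
independently of any dimension. This comes from a bound on `𝔼 exp(c‖y + X‖²)` that can be iterated
over independent summands (`HasSquareExpBound`); overlapping windows are split into `M + 1` families
of disjoint ones. As `d` depends on the data, the covariance is treated as one vector in the tensor
square of the RKHS, so that its deviation controls the quadratic form at all elements
simultaneously.

With `θ = ℓ^(-1/5)` and regularization of order `θ`, regularization costs `θ`, noise `1/(ℓθ) = θ^4`,
and fluctuation of the truncation error `ℓ^(-1/2)`; up to logarithms `‖d‖²` is at most of order
`1/θ`, so passing from the empirical to the expected norm costs `ℓ^(-1/2)/θ = θ^(3/2)`. All are at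
most of order `θ` (`error_rate_arithmetic`). A positive observability constant converts the sampling
norm into the `L²(ν)` norm; when it vanishes, a positive substitute is read off from the bound on
`‖d‖²`. -/

noncomputable section

namespace MSPHS

/-! ### Differentiability of feature maps -/

section FeatureMap

variable {E F : Type*} [NormedAddCommGroup E] [NormedSpace ℝ E]
  [NormedAddCommGroup F] [InnerProductSpace ℝ F]

/-- The derivative in the second variable of a function of two variables. -/
def partialSnd (k : E × E → ℝ) (p : E × E) : E →L[ℝ] ℝ :=
  (fderiv ℝ k p).comp (ContinuousLinearMap.inr ℝ E E)

/-- The mixed second derivative of a function of two variables. -/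
def mixedPartial (k : E × E → ℝ) (p : E × E) : E →L[ℝ] E →L[ℝ] ℝ :=
  (fderiv ℝ (partialSnd k) p).comp (ContinuousLinearMap.inl ℝ E E)

lemma contDiff_partialSnd {k : E × E → ℝ} (hk : ContDiff ℝ 2 k) :
    ContDiff ℝ 1 (partialSnd k) := by
  have h : ContDiff ℝ 1 (fderiv ℝ k) := hk.fderiv_right (by norm_num)
  exact h.clm_comp contDiff_const

lemma hasFDerivAt_snd {k : E × E → ℝ} (hk : ContDiff ℝ 2 k) (x y : E) :
    HasFDerivAt (fun y' => k (x, y')) (partialSnd k (x, y)) y :=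
  ((hk.differentiable (by norm_num) (x, y)).hasFDerivAt).comp y (hasFDerivAt_prodMk_right x y)

lemma hasFDerivAt_partialSnd {k : E × E → ℝ} (hk : ContDiff ℝ 2 k) (x y : E) :
    HasFDerivAt (fun x' => partialSnd k (x', y)) (mixedPartial k (x, y)) x := by
  have h : HasFDerivAt (partialSnd k) (fderiv ℝ (partialSnd k) (x, y)) (x, y) :=
    ((contDiff_partialSnd hk).differentiable (by norm_num) (x, y)).hasFDerivAt
  exact HasFDerivAt.comp (f := fun e : E => (e, y)) x h (hasFDerivAt_prodMk_left (𝕜 := ℝ) x y)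

lemma continuous_mixedPartial {k : E × E → ℝ} (hk : ContDiff ℝ 2 k) :
    Continuous (mixedPartial k) :=
  ((contDiff_partialSnd hk).continuous_fderiv (by norm_num)).clm_comp continuous_const

/-- Second-order differences are approximated by the mixed second derivative. -/
lemma exists_second_difference_bound {k : E × E → ℝ} (hk : ContDiff ℝ 2 k) (z : E) {ε : ℝ}
    (hε : 0 < ε) :
    ∃ δ > 0, ∀ h h' : E, ‖h‖ < δ → ‖h'‖ < δ →
      |k (z + h, z + h') - k (z, z + h') - k (z + h, z) + k (z, z) - mixedPartial k (z, z) h h'|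
        ≤ ε * ‖h‖ * ‖h'‖ := by
  obtain ⟨δ, hδ, hball⟩ := (Metric.continuousAt_iff (α := E × E)
    (β := E →L[ℝ] E →L[ℝ] ℝ) (f := mixedPartial k) (a := (z, z))).1
    (continuous_mixedPartial hk).continuousAt ε hε
  refine ⟨δ, hδ, fun h h' hh hh' => ?_⟩
  have mem : ∀ {v : E}, ‖v‖ < δ → z + v ∈ Metric.ball z δ := fun hv => by simpa using hv
  have hz : z ∈ Metric.ball z δ := Metric.mem_ball_self hδ
  -- The mean value inequality is used twice: here in the first variable for `partialSnd k`, then in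
  -- the second variable for `k (z + h, y) - k (z, y)`. This yields the product `‖h‖ * ‖h'‖` from
  -- continuity of the mixed derivative at `(z, z)`.
  have first : ∀ y ∈ Metric.ball z δ,
      ‖partialSnd k (z + h, y) - partialSnd k (z, y) - mixedPartial k (z, z) h‖ ≤ ε * ‖h‖ := by
    intro y hy
    have := (convex_ball z δ).norm_image_sub_le_of_norm_hasFDerivWithin_le'
      (f := fun x' => partialSnd k (x', y)) (f' := fun x' => mixedPartial k (x', y))
      (φ := mixedPartial k (z, z)) (C := ε)
      (fun x' _ => (hasFDerivAt_partialSnd hk x' y).hasFDerivWithinAt)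
      (fun x' hx' => by
        rw [← dist_eq_norm]
        refine (hball ?_).le
        rw [Prod.dist_eq]
        exact max_lt hx' hy) hz (mem hh)
    simpa using this
  have := (convex_ball z δ).norm_image_sub_le_of_norm_hasFDerivWithin_le'
    (f := fun y => k (z + h, y) - k (z, y))
    (f' := fun y => partialSnd k (z + h, y) - partialSnd k (z, y))
    (φ := mixedPartial k (z, z) h) (C := ε * ‖h‖)
    (fun y _ => ((hasFDerivAt_snd hk _ y).sub (hasFDerivAt_snd hk _ y)).hasFDerivWithinAt)
    first hz (mem hh')
  simp only [add_sub_cancel_left, Real.norm_eq_abs] at this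
  convert this using 2
  ring

/-- Inner products of increments of a feature map are approximated by the mixed second derivative
of its kernel. -/
lemma exists_inner_increment_bound {Φ : E → F}
    (hk : ContDiff ℝ 2 fun p : E × E => inner ℝ (Φ p.1) (Φ p.2)) (z : E) {ε : ℝ} (hε : 0 < ε) :
    ∃ δ > 0, ∀ h h' : E, ‖h‖ < δ → ‖h'‖ < δ →
      |inner ℝ (Φ (z + h) - Φ z) (Φ (z + h') - Φ z)
        - mixedPartial (fun p : E × E => inner ℝ (Φ p.1) (Φ p.2)) (z, z) h h'|
        ≤ ε * ‖h‖ * ‖h'‖ := by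
  obtain ⟨δ, hδ, H⟩ := exists_second_difference_bound hk z hε
  refine ⟨δ, hδ, fun h h' hh hh' => ?_⟩
  convert H h h' hh hh' using 2
  simp only [inner_sub_left, inner_sub_right]
  ring

lemma hasFDerivAt_inner_right {Φ : E → F} (hΦ : Differentiable ℝ Φ) (a : F) (y : E) :
    HasFDerivAt (fun y' => inner ℝ a (Φ y')) ((innerSL ℝ a).comp (fderiv ℝ Φ y)) y :=
  (innerSL ℝ a).hasFDerivAt.comp y (hΦ y).hasFDerivAt

variable [CompleteSpace F]

/-- A feature map whose kernel `⟪Φ x, Φ y⟫` is of class `C²` has directional derivatives. -/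
lemma exists_directional_derivative {Φ : E → F}
    (hk : ContDiff ℝ 2 fun p : E × E => inner ℝ (Φ p.1) (Φ p.2)) (z v : E) {c : ℕ → ℝ}
    (hc0 : Filter.Tendsto c Filter.atTop (nhds 0)) (hcpos : ∀ j, 0 < c j) :
    ∃ d : F, Filter.Tendsto (fun j => (c j)⁻¹ • (Φ (z + c j • v) - Φ z)) Filter.atTop (nhds d) := by
  set m := mixedPartial (fun p : E × E => inner ℝ (Φ p.1) (Φ p.2)) (z, z) with hm
  let Q : ℕ → F := fun j => (c j)⁻¹ • (Φ (z + c j • v) - Φ z)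
  have hcv : ∀ δ > 0, ∀ᶠ j in Filter.atTop, ‖c j • v‖ < δ := by
    intro δ hδ
    have : Filter.Tendsto (fun j => ‖c j • v‖) Filter.atTop (nhds 0) := by
      simpa using (hc0.smul_const v).norm
    exact this.eventually (gt_mem_nhds hδ)
  have hcauchy : CauchySeq Q := by
    rw [Metric.cauchySeq_iff]
    intro ε hε
    -- With this choice all `⟪Q i, Q j⟫` lie within `ε²/8` of `m v v`, so that `‖Q i - Q j‖² ≤ 4
    -- ε²/8 < ε²`. The `+ 1` covers `v = 0`.
    obtain ⟨δ, hδ, H⟩ := exists_inner_increment_bound hk z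
      (show 0 < ε ^ 2 / (8 * (‖v‖ ^ 2 + 1)) by positivity)
    obtain ⟨N, hN⟩ := Filter.eventually_atTop.1 (hcv δ hδ)
    have hQ : ∀ i ≥ N, ∀ j ≥ N, |inner ℝ (Q i) (Q j) - m v v| ≤ ε ^ 2 / 8 := by
      intro i hi j hj
      have h1 := H _ _ (hN i hi) (hN j hj)
      have hpi := hcpos i
      have hpj := hcpos j
      simp only [map_smul, smul_eq_mul, norm_smul, Real.norm_eq_abs, abs_of_pos hpi,
        abs_of_pos hpj, smul_apply] at h1
      have : inner ℝ (Q i) (Q j) - m v v = (c i)⁻¹ * (c j)⁻¹ *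
          (inner ℝ (Φ (z + c i • v) - Φ z) (Φ (z + c j • v) - Φ z) - c j * (c i * m v v)) := by
        simp only [Q, inner_smul_left, inner_smul_right]; simp; field_simp
      rw [this, abs_mul, abs_of_pos (by positivity), ← mul_inv, inv_mul_le_iff₀ (by positivity)]
      refine h1.trans ?_
      have hv : ‖v‖ ^ 2 / (‖v‖ ^ 2 + 1) ≤ 1 := by
        rw [div_le_one (by positivity)]; linarith
      have : ε ^ 2 / (8 * (‖v‖ ^ 2 + 1)) * (c i * ‖v‖) * (c j * ‖v‖)
          = c i * c j * (ε ^ 2 / 8) * (‖v‖ ^ 2 / (‖v‖ ^ 2 + 1)) := by field_simp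
      rw [this]
      exact mul_le_of_le_one_right (by positivity) hv
    refine ⟨N, fun i hi j hj => ?_⟩
    have e : ‖Q i - Q j‖ ^ 2 = inner ℝ (Q i) (Q i) - 2 * inner ℝ (Q i) (Q j)
        + inner ℝ (Q j) (Q j) := by
      rw [norm_sub_sq_real, real_inner_self_eq_norm_sq, real_inner_self_eq_norm_sq]
    have h1 := abs_le.1 (hQ i hi i hi)
    have h2 := abs_le.1 (hQ i hi j hj)
    have h3 := abs_le.1 (hQ j hj j hj)
    rw [dist_eq_norm]
    refine lt_of_pow_lt_pow_left₀ 2 hε.le ?_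
    have : 0 < ε ^ 2 := by positivity
    linarith [h1.2, h2.1, h3.2]
  exact cauchySeq_tendsto_of_complete hcauchy

/-- A feature map with a kernel of class `C²` is differentiable. -/
theorem differentiable_of_contDiff_inner {Φ : E → F}
    (hk : ContDiff ℝ 2 fun p : E × E => inner ℝ (Φ p.1) (Φ p.2)) : Differentiable ℝ Φ := by
  intro z
  set m := mixedPartial (fun p : E × E => inner ℝ (Φ p.1) (Φ p.2)) (z, z) with hm
  let c : ℕ → ℝ := fun j => 1 / ((j : ℝ) + 1)
  have hc0 : Filter.Tendsto c Filter.atTop (nhds 0) := tendsto_one_div_add_atTop_nhds_zero_nat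
  have hcpos : ∀ j, 0 < c j := fun j => by positivity
  choose D hD using fun v => exists_directional_derivative hk z v hc0 hcpos
  have hcv : ∀ v : E, ∀ δ > 0, ∀ᶠ j in Filter.atTop, ‖c j • v‖ < δ := by
    intro v δ hδ
    have : Filter.Tendsto (fun j => ‖c j • v‖) Filter.atTop (nhds 0) := by
      simpa using (hc0.smul_const v).norm
    exact this.eventually (gt_mem_nhds hδ)
  -- The second estimate is the limit of the increment bound with `h' = c j • v` after division by
  -- `c j`; since only small `h'` matter, `δ` does not depend on `v`.
  have hcross : ∀ ε > 0, ∃ δ > 0, ∀ h v : E, ‖h‖ < δ →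
      |inner ℝ (Φ (z + h) - Φ z) (Φ (z + h) - Φ z) - m h h| ≤ ε * ‖h‖ * ‖h‖ ∧
      |inner ℝ (Φ (z + h) - Φ z) (D v) - m h v| ≤ ε * ‖h‖ * ‖v‖ := by
    intro ε hε
    obtain ⟨δ, hδ, H⟩ := exists_inner_increment_bound hk z hε
    refine ⟨δ, hδ, fun h v hh => ⟨H h h hh hh, ?_⟩⟩
    refine le_of_tendsto ((tendsto_const_nhds.inner (hD v)).sub_const _).abs ?_
    filter_upwards [hcv v δ hδ] with j hj
    have h1 := H h (c j • v) hh hj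
    have hp := hcpos j
    rw [map_smul, norm_smul, Real.norm_eq_abs, abs_of_pos hp, smul_eq_mul] at h1
    rw [inner_smul_right, show (c j)⁻¹ * inner ℝ (Φ (z + h) - Φ z) (Φ (z + c j • v) - Φ z) - m h v
        = (c j)⁻¹ * (inner ℝ (Φ (z + h) - Φ z) (Φ (z + c j • v) - Φ z) - c j * m h v) by
          field_simp, abs_mul, abs_of_pos (inv_pos.2 hp), inv_mul_le_iff₀ hp]
    linarith
  have hinner : ∀ v w, inner ℝ (D v) (D w) = m v w := by
    intro v w
    have bound : ∀ ε > 0, |inner ℝ (D v) (D w) - m v w| ≤ ε * ‖v‖ * ‖w‖ := by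
      intro ε hε
      obtain ⟨δ, hδ, H⟩ := hcross ε hε
      refine le_of_tendsto (((hD v).inner tendsto_const_nhds).sub_const _).abs ?_
      filter_upwards [hcv v δ hδ] with j hj
      have h1 := (H _ w hj).2
      have hp := hcpos j
      rw [map_smul, norm_smul, Real.norm_eq_abs, abs_of_pos hp, smul_apply, smul_eq_mul] at h1
      rw [real_inner_smul_left, show (c j)⁻¹ * inner ℝ (Φ (z + c j • v) - Φ z) (D w) - m v w
          = (c j)⁻¹ * (inner ℝ (Φ (z + c j • v) - Φ z) (D w) - c j * m v w) by field_simp,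
        abs_mul, abs_of_pos (inv_pos.2 hp), inv_mul_le_iff₀ hp]
      linarith
    have : |inner ℝ (D v) (D w) - m v w| ≤ 0 := by
      refine le_of_forall_pos_le_add fun ε hε => ?_
      have := bound (ε / (‖v‖ * ‖w‖ + 1)) (by positivity)
      refine this.trans ?_
      rw [zero_add, mul_assoc, div_mul_eq_mul_div, div_le_iff₀ (by positivity)]
      nlinarith [mul_nonneg (norm_nonneg v) (norm_nonneg w)]
    exact sub_eq_zero.1 (abs_nonpos_iff.1 this)
  have zero_of : ∀ a : F, inner ℝ a a = 0 → a = 0 := fun a h => inner_self_eq_zero.1 h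
  -- Linearity is inherited from `m`: by `hinner` the squared norm of each linearity defect of `D`
  -- is a combination of values of `m` that cancels by bilinearity.
  let L : E →ₗ[ℝ] F :=
    { toFun := D
      map_add' := fun v w => by
        refine sub_eq_zero.1 (zero_of _ ?_)
        simp only [inner_sub_left, inner_sub_right, inner_add_left, inner_add_right, hinner,
          map_add, add_apply]
        ring
      map_smul' := fun r v => by
        refine sub_eq_zero.1 (zero_of _ ?_)
        simp only [inner_sub_left, inner_sub_right, inner_smul_left, inner_smul_right, hinner,
          map_smul, smul_apply]
        simp }
  let Lc : E →L[ℝ] F := L.mkContinuous (Real.sqrt ‖m‖) fun v => by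
    have h1 : ‖D v‖ ^ 2 ≤ ‖m‖ * ‖v‖ ^ 2 := by
      rw [← real_inner_self_eq_norm_sq, hinner]
      calc m v v ≤ ‖m v v‖ := le_abs_self _
        _ ≤ ‖m‖ * ‖v‖ * ‖v‖ := m.le_opNorm₂ v v
        _ = _ := by ring
    calc ‖D v‖ = Real.sqrt (‖D v‖ ^ 2) := (Real.sqrt_sq (norm_nonneg _)).symm
      _ ≤ Real.sqrt (‖m‖ * ‖v‖ ^ 2) := Real.sqrt_le_sqrt h1
      _ = _ := by rw [Real.sqrt_mul (norm_nonneg m), Real.sqrt_sq (norm_nonneg v)]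
  refine HasFDerivAt.differentiableAt (f' := Lc) ?_
  rw [hasFDerivAt_iff_isLittleO_nhds_zero, Asymptotics.isLittleO_iff]
  intro c hc
  -- In the expansion of `‖Φ (z + h) - Φ z - D h‖²` the terms `m h h` cancel, and the errors enter
  -- with weights 1 and 2, hence the third.
  obtain ⟨δ, hδ, H⟩ := hcross (c ^ 2 / 3) (by positivity)
  refine Metric.eventually_nhds_iff.2 ⟨δ, hδ, fun h hh => ?_⟩
  rw [dist_zero_right] at hh
  have hLc : Lc h = D h := rfl
  have a1 := abs_le.1 (H h h hh).1
  have a2 := abs_le.1 (H h h hh).2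
  have e : ‖Φ (z + h) - Φ z - D h‖ ^ 2 = inner ℝ (Φ (z + h) - Φ z) (Φ (z + h) - Φ z)
      - 2 * inner ℝ (Φ (z + h) - Φ z) (D h) + m h h := by
    rw [norm_sub_sq_real, ← real_inner_self_eq_norm_sq, ← real_inner_self_eq_norm_sq (D h), hinner]
  rw [hLc]
  refine le_of_sq_le_sq ?_ (by positivity)
  rw [e]
  nlinarith [a1.2, a2.1]

/-- Both sides are the derivative in direction `v` of the same function `x' ↦ ⟪Φ x', fderiv ℝ Φ y
w⟫`. -/
lemma mixedPartial_inner {Φ : E → F}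
    (hk : ContDiff ℝ 2 fun p : E × E => inner ℝ (Φ p.1) (Φ p.2)) (x y v w : E) :
    mixedPartial (fun p : E × E => inner ℝ (Φ p.1) (Φ p.2)) (x, y) v w
      = inner ℝ (fderiv ℝ Φ x v) (fderiv ℝ Φ y w) := by
  have hΦ := differentiable_of_contDiff_inner hk
  have e : ∀ x', partialSnd (fun p : E × E => inner ℝ (Φ p.1) (Φ p.2)) (x', y)
      = (innerSL ℝ (Φ x')).comp (fderiv ℝ Φ y) := fun x' =>
    (hasFDerivAt_snd hk x' y).unique (hasFDerivAt_inner_right hΦ (Φ x') y)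
  have h1 := (hasFDerivAt_partialSnd hk x y).clm_apply (hasFDerivAt_const w x)
  have h2 : HasFDerivAt (fun x' => inner ℝ (fderiv ℝ Φ y w) (Φ x'))
      ((innerSL ℝ (fderiv ℝ Φ y w)).comp (fderiv ℝ Φ x)) x := hasFDerivAt_inner_right hΦ _ x
  have h3 := h1.unique (h2.congr_of_eventuallyEq (Filter.Eventually.of_forall fun x' => by
    simp only [e, ContinuousLinearMap.comp_apply, innerSL_apply_apply]
    exact real_inner_comm _ _))
  have := congrArg (fun T : E →L[ℝ] ℝ => T v) h3
  simp at this
  rw [this, real_inner_comm]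

/-- The squared distance between two values of the derivative is a combination of three values of
the continuous mixed derivative, and it vanishes on the diagonal. -/
lemma continuous_fderiv_apply {Φ : E → F}
    (hk : ContDiff ℝ 2 fun p : E × E => inner ℝ (Φ p.1) (Φ p.2)) (v : E) :
    Continuous fun z => fderiv ℝ Φ z v := by
  rw [continuous_iff_continuousAt]
  intro z
  rw [ContinuousAt, tendsto_iff_norm_sub_tendsto_zero]
  set M := fun p => mixedPartial (fun p : E × E => inner ℝ (Φ p.1) (Φ p.2)) p v v with hM
  have hMc : Continuous M := ((continuous_mixedPartial hk).clm_apply continuous_const).clm_apply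
    continuous_const
  have e : ∀ y, ‖fderiv ℝ Φ y v - fderiv ℝ Φ z v‖
      = Real.sqrt (M (y, y) - 2 * M (y, z) + M (z, z)) := by
    intro y
    simp only [hM, mixedPartial_inner hk]
    rw [← Real.sqrt_sq (norm_nonneg (fderiv ℝ Φ y v - fderiv ℝ Φ z v)), norm_sub_sq_real,
      real_inner_self_eq_norm_sq, real_inner_self_eq_norm_sq]
  simp only [e]
  have : Continuous fun y => Real.sqrt (M (y, y) - 2 * M (y, z) + M (z, z)) := by fun_prop
  convert this.tendsto z using 2
  rw [show M (z, z) - 2 * M (z, z) + M (z, z) = 0 by ring, Real.sqrt_zero]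

end FeatureMap

/-! ### Concentration of sums of independent Hilbert space valued random variables -/

section Concentration

variable {Ω : Type*} [MeasurableSpace Ω] {F : Type*} [NormedAddCommGroup F]

/-- A random vector `X` such that adding `X` to a fixed vector `y` increases the exponential moments
of the squared norm not more than a centred Gaussian of variance comparable to `v` does. -/
def HasSquareExpBound (P : Measure Ω) (v : ℝ) (X : Ω → F) : Prop :=
  -- For a real centred Gaussian of variance `v/2` the left side equals `(1 - 1/r)^(-1/2)
  -- exp(y²/(v(r-1)))`. Thus adding one term lowers `r` by one at the price of a factor `exp(1/r)`,
  -- which is the form that can be iterated.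
  ∀ r : ℝ, 2 ≤ r → ∀ y : F,
    ∫⁻ w, ENNReal.ofReal (Real.exp (‖y + X w‖ ^ 2 / (v * r))) ∂P ≤
      ENNReal.ofReal (Real.exp (1 / r + ‖y‖ ^ 2 / (v * (r - 1))))

/-- Expand `‖y + X‖²`: the square of `X` is at most `b²`, and Hoeffding's lemma handles the centred
variable `⟪y, X⟫`. The coefficient of `‖y‖²` fits because `(r + 1)(r - 1) ≤ r²`. -/
lemma hasSquareExpBound_of_norm_le {P : Measure Ω} [IsProbabilityMeasure P]
    [InnerProductSpace ℝ F] [CompleteSpace F] {X : Ω → F} (hX : AEStronglyMeasurable X P)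
    {b : ℝ} (hb : 0 < b) (hXb : ∀ᵐ w ∂P, ‖X w‖ ≤ b)
    (hX0 : ∫ w, X w ∂P = 0) : HasSquareExpBound P (2 * b ^ 2) X := by
  intro r hr y
  have hXint : Integrable X P := Integrable.of_bound hX b hXb
  set s : ℝ := 1 / (2 * b ^ 2 * r) with hs
  have hspos : 0 < s := by positivity
  have hsub : HasSubgaussianMGF (fun w => inner ℝ y (X w))
      ((‖b * ‖y‖ - -(b * ‖y‖)‖₊ / 2) ^ 2) P := by
    refine hasSubgaussianMGF_of_mem_Icc_of_integral_eq_zero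
      (hX.const_inner (c := y)).aemeasurable ?_ ?_
    · filter_upwards [hXb] with w hw
      refine abs_le.1 ((abs_real_inner_le_norm _ _).trans ?_)
      rw [mul_comm]
      gcongr
    · rw [integral_inner hXint, hX0, inner_zero_right]
  have hmgf := hsub.mgf_le (2 * s)
  have hc : (((‖b * ‖y‖ - -(b * ‖y‖)‖₊ / 2) ^ 2 : ℝ≥0) : ℝ) = b ^ 2 * ‖y‖ ^ 2 := by
    push_cast
    rw [Real.norm_eq_abs, abs_of_nonneg (by nlinarith [norm_nonneg y])]
    ring
  rw [hc] at hmgf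
  calc ∫⁻ w, ENNReal.ofReal (Real.exp (‖y + X w‖ ^ 2 / (2 * b ^ 2 * r))) ∂P
      ≤ ∫⁻ w, ENNReal.ofReal (Real.exp (s * ‖y‖ ^ 2 + s * b ^ 2)) *
          ENNReal.ofReal (Real.exp (2 * s * inner ℝ y (X w))) ∂P := by
        refine lintegral_mono_ae ?_
        filter_upwards [hXb] with w hw
        rw [← ENNReal.ofReal_mul (Real.exp_pos _).le, ← Real.exp_add]
        refine ENNReal.ofReal_le_ofReal (Real.exp_le_exp.2 ?_)
        rw [norm_add_sq_real, div_eq_mul_one_div, ← hs]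
        have : ‖X w‖ ^ 2 ≤ b ^ 2 := pow_le_pow_left₀ (norm_nonneg _) hw 2
        nlinarith
    _ = ENNReal.ofReal (Real.exp (s * ‖y‖ ^ 2 + s * b ^ 2)) *
          ENNReal.ofReal (mgf (fun w => inner ℝ y (X w)) P (2 * s)) := by
        rw [lintegral_const_mul' _ _ ENNReal.ofReal_ne_top, mgf,
          ofReal_integral_eq_lintegral_ofReal (hsub.integrable_exp_mul _)
            (Filter.Eventually.of_forall fun _ => (Real.exp_pos _).le)]
    _ ≤ ENNReal.ofReal (Real.exp (s * ‖y‖ ^ 2 + s * b ^ 2)) *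
          ENNReal.ofReal (Real.exp (b ^ 2 * ‖y‖ ^ 2 * (2 * s) ^ 2 / 2)) := by gcongr
    _ ≤ _ := by
        rw [← ENNReal.ofReal_mul (Real.exp_pos _).le, ← Real.exp_add]
        refine ENNReal.ofReal_le_ofReal (Real.exp_le_exp.2 ?_)
        have hr1 : 0 < r - 1 := by linarith
        have e1 : s * b ^ 2 = 1 / (2 * r) := by rw [hs]; field_simp
        have e2 : s * ‖y‖ ^ 2 + b ^ 2 * ‖y‖ ^ 2 * (2 * s) ^ 2 / 2
            = ‖y‖ ^ 2 / (2 * b ^ 2) * ((r + 1) / r ^ 2) := by rw [hs]; field_simp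
        have e3 : ‖y‖ ^ 2 / (2 * b ^ 2 * (r - 1)) = ‖y‖ ^ 2 / (2 * b ^ 2) * (1 / (r - 1)) := by
          field_simp
        have e4 : (r + 1) / r ^ 2 ≤ 1 / (r - 1) := by
          rw [div_le_div_iff₀ (by positivity) hr1]; nlinarith
        have e5 : 1 / (2 * r) ≤ 1 / r := by
          apply one_div_le_one_div_of_le <;> linarith
        have e6 := mul_le_mul_of_nonneg_left e4 (show 0 ≤ ‖y‖ ^ 2 / (2 * b ^ 2) by positivity)
        rw [e3]
        linarith

/-- Complete the square: with `q = 1 - 2cσ2`, integrand times density is a constant multiple of the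
Gaussian density of mean `aσ2/q` and variance `σ2/q`. -/
lemma lintegral_gaussian_exp_quadratic {σ2 : ℝ≥0} (hσ : σ2 ≠ 0) {a c : ℝ}
    (hc : 2 * c * σ2 < 1) :
    ∫⁻ e, ENNReal.ofReal (Real.exp (a * e + c * e ^ 2)) ∂(gaussianReal 0 σ2) =
      ENNReal.ofReal ((Real.sqrt (1 - 2 * c * σ2))⁻¹ *
        Real.exp (a ^ 2 * σ2 / (2 * (1 - 2 * c * σ2)))) := by
  have hσpos : (0 : ℝ) < σ2 := lt_of_le_of_ne σ2.coe_nonneg (by simpa [eq_comm] using hσ)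
  set q : ℝ := 1 - 2 * c * σ2 with hq
  have hqpos : 0 < q := by rw [hq]; linarith
  let τ : ℝ≥0 := ⟨σ2 / q, by positivity⟩
  have hτ : (τ : ℝ) = σ2 / q := rfl
  have hτ0 : τ ≠ 0 := by
    intro h
    have : (τ : ℝ) = 0 := by rw [h]; rfl
    rw [hτ] at this
    exact (div_pos hσpos hqpos).ne' this
  rw [gaussianReal_of_var_ne_zero _ hσ, lintegral_withDensity_eq_lintegral_mul _
    (measurable_gaussianPDF _ _) (by fun_prop)]
  have e : ∀ x : ℝ, (gaussianPDF 0 σ2 * fun e => ENNReal.ofReal (Real.exp (a * e + c * e ^ 2))) x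
      = ENNReal.ofReal ((Real.sqrt q)⁻¹ * Real.exp (a ^ 2 * σ2 / (2 * q))) *
        gaussianPDF (a * σ2 / q) τ x := by
    intro x
    rw [Pi.mul_apply, gaussianPDF, gaussianPDF, ← ENNReal.ofReal_mul (gaussianPDFReal_nonneg _ _ _),
      ← ENNReal.ofReal_mul (by positivity)]
    congr 1
    rw [gaussianPDFReal, gaussianPDFReal, hτ]
    have h1 : Real.sqrt (2 * Real.pi * (σ2 / q)) = Real.sqrt (2 * Real.pi * σ2) / Real.sqrt q := by
      rw [← Real.sqrt_div (by positivity), mul_div_assoc]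
    rw [h1]
    have hsq : Real.sqrt q ≠ 0 := (Real.sqrt_pos.2 hqpos).ne'
    have h2 : -(x - 0) ^ 2 / (2 * (σ2 : ℝ)) + (a * x + c * x ^ 2) = a ^ 2 * σ2 / (2 * q) +
        -(x - a * σ2 / q) ^ 2 / (2 * (σ2 / q)) := by
      have : c = (1 - q) / (2 * σ2) := by rw [hq]; field_simp; ring
      rw [this]
      field_simp
      ring
    calc _ = (Real.sqrt (2 * Real.pi * σ2))⁻¹ *
          Real.exp (-(x - 0) ^ 2 / (2 * (σ2 : ℝ)) + (a * x + c * x ^ 2)) := by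
          rw [mul_assoc, ← Real.exp_add]
      _ = _ := by
          rw [h2, Real.exp_add]
          field_simp
  simp_rw [e]
  rw [lintegral_const_mul _ (measurable_gaussianPDF _ _), lintegral_gaussianPDF_eq_one _ hτ0,
    mul_one]

lemma inv_sqrt_one_sub_le_exp {x : ℝ} (h0 : 0 ≤ x) (h : x ≤ 1 / 2) :
    (Real.sqrt (1 - x))⁻¹ ≤ Real.exp x := by
  have h1 : Real.exp (-(2 * x)) ≤ 1 - x := by
    have := Real.add_one_le_exp (2 * x)
    rw [Real.exp_neg, inv_le_comm₀ (Real.exp_pos _) (by linarith)]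
    refine le_trans ?_ this
    rw [inv_le_iff_one_le_mul₀ (by linarith)]
    nlinarith
  have h2 : Real.exp (-x) ≤ Real.sqrt (1 - x) := by
    refine Real.le_sqrt_of_sq_le ?_
    rw [← Real.exp_nat_mul]
    convert h1 using 2
    push_cast; ring
  rw [inv_le_comm₀ (Real.sqrt_pos.2 (by linarith)) (Real.exp_pos _), ← Real.exp_neg]
  exact h2

lemma hasSquareExpBound_gaussian_smul [InnerProductSpace ℝ F] {P : Measure Ω} {σ2 : ℝ≥0} {e : Ω → ℝ}
    (he : HasLaw e (gaussianReal 0 σ2) P) {u : F} {v : ℝ} (hv : 0 < v)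
    (huv : 2 * σ2 * ‖u‖ ^ 2 ≤ v) : HasSquareExpBound P v (fun w => e w • u) := by
  intro r hr y
  have hr1 : 0 < r - 1 := by linarith
  have hr0 : 0 < r := by linarith
  have hlaw := he.lintegral_comp
    (f := fun x => ENNReal.ofReal (Real.exp (‖y + x • u‖ ^ 2 / (v * r))))
    (ENNReal.continuous_ofReal.comp (by fun_prop)).measurable.aemeasurable
  rw [hlaw]
  set s : ℝ := 1 / (v * r) with hs
  have hspos : 0 < s := by positivity
  have expand : ∀ x : ℝ, ‖y + x • u‖ ^ 2 / (v * r)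
      = s * ‖y‖ ^ 2 + (2 * s * inner ℝ y u * x + s * ‖u‖ ^ 2 * x ^ 2) := by
    intro x
    rw [norm_add_sq_real, inner_smul_right, norm_smul, mul_pow, Real.norm_eq_abs, sq_abs,
      div_eq_mul_one_div, ← hs]
    ring
  have hmono : s * ‖y‖ ^ 2 ≤ ‖y‖ ^ 2 / (v * (r - 1)) := by
    rw [hs, one_div_mul_eq_div]
    gcongr
    linarith
  -- A Gaussian of variance zero is a point mass, to which the density formula does not apply.
  by_cases hσ : σ2 = 0
  · rw [hσ, gaussianReal_zero_var, lintegral_dirac]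
    refine ENNReal.ofReal_le_ofReal (Real.exp_le_exp.2 ?_)
    rw [expand]
    have : 0 < 1 / r := by positivity
    simp only [mul_zero, ne_eq, OfNat.ofNat_ne_zero, not_false_eq_true, zero_pow, add_zero]
    linarith
  have hx : 2 * (s * ‖u‖ ^ 2) * σ2 ≤ 1 / r := by
    rw [hs, show 2 * (1 / (v * r) * ‖u‖ ^ 2) * (σ2 : ℝ) = (2 * σ2 * ‖u‖ ^ 2) / v * (1 / r) by
      field_simp]
    refine mul_le_of_le_one_left (by positivity) ((div_le_one hv).2 huv)
  have hr2 : 1 / r ≤ 1 / 2 := one_div_le_one_div_of_le (by norm_num) hr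
  have hx0 : 0 ≤ 2 * (s * ‖u‖ ^ 2) * σ2 := by positivity
  calc ∫⁻ x, ENNReal.ofReal (Real.exp (‖y + x • u‖ ^ 2 / (v * r))) ∂(gaussianReal 0 σ2)
      = ENNReal.ofReal (Real.exp (s * ‖y‖ ^ 2)) * ∫⁻ x, ENNReal.ofReal (Real.exp
          (2 * s * inner ℝ y u * x + s * ‖u‖ ^ 2 * x ^ 2)) ∂(gaussianReal 0 σ2) := by
        rw [← lintegral_const_mul' _ _ ENNReal.ofReal_ne_top]
        refine lintegral_congr fun x => ?_
        rw [← ENNReal.ofReal_mul (Real.exp_pos _).le, ← Real.exp_add, expand]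
    _ = ENNReal.ofReal (Real.exp (s * ‖y‖ ^ 2) * ((Real.sqrt (1 - 2 * (s * ‖u‖ ^ 2) * σ2))⁻¹ *
        Real.exp ((2 * s * inner ℝ y u) ^ 2 * σ2 / (2 * (1 - 2 * (s * ‖u‖ ^ 2) * σ2))))) := by
        rw [lintegral_gaussian_exp_quadratic hσ (by linarith),
          ← ENNReal.ofReal_mul (Real.exp_pos _).le]
    _ ≤ _ := by
        refine ENNReal.ofReal_le_ofReal ?_
        have h1 : (Real.sqrt (1 - 2 * (s * ‖u‖ ^ 2) * σ2))⁻¹ ≤ Real.exp (1 / r) :=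
          (inv_sqrt_one_sub_le_exp hx0 (by linarith)).trans (Real.exp_le_exp.2 hx)
        have hin : inner ℝ y u ^ 2 ≤ ‖y‖ ^ 2 * ‖u‖ ^ 2 := by
          rw [← mul_pow, ← sq_abs]
          exact pow_le_pow_left₀ (abs_nonneg _) (abs_real_inner_le_norm _ _) 2
        have h2 : (2 * s * inner ℝ y u) ^ 2 * σ2 / (2 * (1 - 2 * (s * ‖u‖ ^ 2) * σ2))
            ≤ s * ‖y‖ ^ 2 * (1 / (r - 1)) := by
          rw [div_le_iff₀ (by linarith)]
          have a1 : (2 * s * inner ℝ y u) ^ 2 * σ2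
              ≤ (2 * s * ‖y‖ ^ 2) * (2 * (s * ‖u‖ ^ 2) * σ2) := by
            have := mul_le_mul_of_nonneg_left hin (show 0 ≤ 4 * s ^ 2 * (σ2 : ℝ) by positivity)
            nlinarith
          have a2 : (1 / (r - 1)) * (1 - 1 / r) = 1 / r := by field_simp
          calc _ ≤ (2 * s * ‖y‖ ^ 2) * (2 * (s * ‖u‖ ^ 2) * σ2) := a1
            _ ≤ (2 * s * ‖y‖ ^ 2) * (1 / r) := by gcongr
            _ = 2 * s * ‖y‖ ^ 2 * ((1 / (r - 1)) * (1 - 1 / r)) := by rw [a2]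
            _ ≤ 2 * s * ‖y‖ ^ 2 * ((1 / (r - 1)) * (1 - 2 * (s * ‖u‖ ^ 2) * σ2)) := by gcongr
            _ = _ := by ring
        have e3 : s * ‖y‖ ^ 2 + s * ‖y‖ ^ 2 * (1 / (r - 1)) = ‖y‖ ^ 2 / (v * (r - 1)) := by
          rw [hs]; field_simp; ring
        calc _ ≤ Real.exp (s * ‖y‖ ^ 2) * (Real.exp (1 / r) *
              Real.exp (s * ‖y‖ ^ 2 * (1 / (r - 1)))) := by gcongr
          _ = _ := by rw [← Real.exp_add, ← Real.exp_add, ← e3]; congr 1; ring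

/-- By Fubini the value of `T` can be frozen, and the bound for `X` is applied with `y = S (T w)`.
-/
lemma lintegral_exp_norm_add_sq_le {P : Measure Ω} [IsProbabilityMeasure P] {α β : Type*}
    [MeasurableSpace α] [MeasurableSpace β] {T : Ω → α} {U : Ω → β} (hT : AEMeasurable T P)
    (hU : AEMeasurable U P) (hTU : IndepFun T U P) {S : α → F} (hS : StronglyMeasurable S)
    {X : β → F} (hX : StronglyMeasurable X) {v r : ℝ}
    (hXv : HasSquareExpBound P v (fun w => X (U w))) (hr : 2 ≤ r) :
    ∫⁻ w, ENNReal.ofReal (Real.exp (‖S (T w) + X (U w)‖ ^ 2 / (v * r))) ∂P ≤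
      ENNReal.ofReal (Real.exp (1 / r)) *
        ∫⁻ w, ENNReal.ofReal (Real.exp (‖S (T w)‖ ^ 2 / (v * (r - 1)))) ∂P := by
  let G : α × β → ℝ≥0∞ := fun p => ENNReal.ofReal (Real.exp (‖S p.1 + X p.2‖ ^ 2 / (v * r)))
  have hG : Measurable G := by
    have : StronglyMeasurable fun p : α × β => S p.1 + X p.2 :=
      (hS.comp_measurable measurable_fst).add (hX.comp_measurable measurable_snd)
    have := this.norm.measurable
    fun_prop
  have hmap := (indepFun_iff_map_prod_eq_prod_map_map hT hU).1 hTU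
  have : IsProbabilityMeasure (P.map U) := Measure.isProbabilityMeasure_map hU
  calc ∫⁻ w, G (T w, U w) ∂P = ∫⁻ p, G p ∂(P.map fun w => (T w, U w)) :=
        (lintegral_map' hG.aemeasurable (hT.prodMk hU)).symm
    _ = ∫⁻ a, ∫⁻ b, G (a, b) ∂(P.map U) ∂(P.map T) := by
        rw [hmap, lintegral_prod _ hG.aemeasurable]
    _ ≤ ∫⁻ a, ENNReal.ofReal (Real.exp (1 / r)) *
          ENNReal.ofReal (Real.exp (‖S a‖ ^ 2 / (v * (r - 1)))) ∂(P.map T) := by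
        refine lintegral_mono fun a => ?_
        rw [lintegral_map' (by fun_prop) hU, ← ENNReal.ofReal_mul (Real.exp_pos _).le,
          ← Real.exp_add]
        exact hXv r hr (S a)
    _ = _ := by
        have hm := hS.norm.measurable
        have : Measurable fun a => ENNReal.ofReal (Real.exp (‖S a‖ ^ 2 / (v * (r - 1)))) := by
          fun_prop
        rw [lintegral_const_mul' _ _ ENNReal.ofReal_ne_top, lintegral_map' this.aemeasurable hT]

/-- Exponential moments of the squared norm of a sum of functions of disjoint blocks of independent
random variables. -/
lemma lintegral_exp_norm_sum_sq_le_of_card {P : Measure Ω} [IsProbabilityMeasure P] {κ ι β : Type*}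
    [MeasurableSpace β] [DecidableEq κ] [DecidableEq ι] {Y : κ → Ω → β}
    (hYm : ∀ a, AEMeasurable (Y a) P) (hY : iIndepFun Y P) (s : ι → Finset κ)
    {X : (i : ι) → (s i → β) → F} (hXm : ∀ i, StronglyMeasurable (X i)) {v N : ℝ} (hN : 1 ≤ N)
    (I : Finset ι)
    (hs : ∀ i ∈ I, ∀ j ∈ I, i ≠ j → Disjoint (s i) (s j))
    (hX : ∀ i ∈ I, HasSquareExpBound P v (fun w => X i (fun a => Y a w))) :
    ∫⁻ w, ENNReal.ofReal (Real.exp (‖∑ i ∈ I, X i (fun a => Y a w)‖ ^ 2 / (v * (N + I.card)))) ∂P ≤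
      ENNReal.ofReal (Real.exp (I.card / N)) := by
  induction I using Finset.induction_on with
  | empty => simp
  | insert i I hi ih =>
    have ih := ih (fun j hj l hl => hs j (Finset.mem_insert_of_mem hj) l
      (Finset.mem_insert_of_mem hl)) (fun j hj => hX j (Finset.mem_insert_of_mem hj))
    let Tset : Finset κ := I.biUnion s
    have hdisj : Disjoint Tset (s i) := by
      rw [Finset.disjoint_biUnion_left]
      intro j hj
      exact hs j (Finset.mem_insert_of_mem hj) i (Finset.mem_insert_self _ _)
        (fun h => hi (h ▸ hj))
    have hindep := hY.indepFun_finset₀ Tset (s i) hdisj hYm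
    let S : (Tset → β) → F := fun y => ∑ j ∈ I.attach,
      X j.1 (fun a => y ⟨a.1, Finset.mem_biUnion.2 ⟨j.1, j.2, a.2⟩⟩)
    have hS : StronglyMeasurable S := by
      refine Finset.stronglyMeasurable_fun_sum _ fun j _ => (hXm j.1).comp_measurable ?_
      exact measurable_pi_lambda _ fun a => measurable_pi_apply _
    have hSeq : ∀ w, S (fun a => Y a w) = ∑ j ∈ I, X j (fun a => Y a w) := fun w =>
      Finset.sum_attach I (fun j => X j (fun a => Y a w))
    have hcard : ((insert i I).card : ℝ) = I.card + 1 := by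
      rw [Finset.card_insert_of_notMem hi]; push_cast; rfl
    have hI0 : (0 : ℝ) ≤ I.card := by positivity
    -- The parameter drops from `N + |I| + 1` to `N + |I|`, exactly the one of the induction
    -- hypothesis.
    have step := lintegral_exp_norm_add_sq_le (aemeasurable_pi_lambda _ fun a => hYm _)
      (aemeasurable_pi_lambda _ fun a => hYm _) hindep hS (hXm i)
      (hX i (Finset.mem_insert_self _ _)) (r := N + I.card + 1) (by linarith)
    simp only [hSeq, add_sub_cancel_right] at step
    rw [hcard, ← add_assoc]
    simp only [Finset.sum_insert hi, add_comm (X i _)]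
    refine step.trans ((mul_le_mul_right ih _).trans ?_)
    rw [← ENNReal.ofReal_mul (Real.exp_pos _).le, ← Real.exp_add]
    refine ENNReal.ofReal_le_ofReal (Real.exp_le_exp.2 ?_)
    have : 1 / (N + I.card + 1) ≤ 1 / N := one_div_le_one_div_of_le (by linarith) (by linarith)
    rw [add_div]
    linarith

/-- With at most `N` summands the final parameter is at most `2N`, while the accumulated factor
`exp(|I|/N)` stays below `e`. -/
lemma lintegral_exp_norm_sum_sq_le {P : Measure Ω} [IsProbabilityMeasure P] {κ ι β : Type*}
    [MeasurableSpace β] [DecidableEq κ] [DecidableEq ι] {Y : κ → Ω → β}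
    (hYm : ∀ a, AEMeasurable (Y a) P) (hY : iIndepFun Y P) (s : ι → Finset κ)
    {X : (i : ι) → (s i → β) → F} (hXm : ∀ i, StronglyMeasurable (X i)) {v N : ℝ} (hv : 0 < v)
    (hN : 1 ≤ N) (I : Finset ι) (hI : (I.card : ℝ) ≤ N)
    (hs : ∀ i ∈ I, ∀ j ∈ I, i ≠ j → Disjoint (s i) (s j))
    (hX : ∀ i ∈ I, HasSquareExpBound P v (fun w => X i (fun a => Y a w))) :
    ∫⁻ w, ENNReal.ofReal (Real.exp (‖∑ i ∈ I, X i (fun a => Y a w)‖ ^ 2 / (2 * v * N))) ∂P ≤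
      ENNReal.ofReal (Real.exp 1) := by
  refine le_trans (lintegral_mono fun w => ?_)
    ((lintegral_exp_norm_sum_sq_le_of_card hYm hY s hXm hN I hs hX).trans ?_)
  · refine ENNReal.ofReal_le_ofReal (Real.exp_le_exp.2 ?_)
    have : (0 : ℝ) ≤ I.card := by positivity
    refine div_le_div_of_nonneg_left (by positivity) (by positivity) ?_
    nlinarith
  · refine ENNReal.ofReal_le_ofReal (Real.exp_le_exp.2 ?_)
    exact (div_le_one (by linarith)).2 hI

/-- Concentration for functions of sliding windows of independent random variables. -/
lemma lintegral_exp_norm_window_sum_sq_le [InnerProductSpace ℝ F] [CompleteSpace F] {P : Measure Ω}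
    [IsProbabilityMeasure P] {K M : ℕ} (hKM : M < K) {t : Fin K → Ω → ℝ}
    (htm : ∀ i, Measurable (t i)) (ht : iIndepFun t P) {G : (Fin (M + 1) → ℝ) → F}
    (hG : StronglyMeasurable G) {b : ℝ} (hb : 0 < b) (hGb : ∀ y, ‖G y‖ ≤ b) :
    ∫⁻ w, ENNReal.ofReal (Real.exp (‖∑ k : Fin (K - M), (G (fun j => t (winNode k j) w)
        - ∫ w', G (fun j => t (winNode k j) w') ∂P)‖ ^ 2 /
        (16 * b ^ 2 * (M + 1) ^ 2 * ((K - M : ℕ) : ℝ)))) ∂P ≤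
      ENNReal.ofReal ((M + 1) * Real.exp 1) := by
  set ℓ : ℝ := ((K - M : ℕ) : ℝ) with hℓ
  have hℓ1 : 1 ≤ ℓ := by rw [hℓ]; exact_mod_cast Nat.le_sub_of_add_le (by omega)
  let s : Fin (K - M) → Finset (Fin K) := fun k => Finset.univ.image (winNode k)
  have hmem : ∀ (k : Fin (K - M)) (j : Fin (M + 1)), winNode k j ∈ s k := fun k j =>
    Finset.mem_image_of_mem _ (Finset.mem_univ _)
  let m : Fin (K - M) → F := fun k => ∫ w', G (fun j => t (winNode k j) w') ∂P
  let X : (k : Fin (K - M)) → (s k → ℝ) → F := fun k y =>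
    G (fun j => y ⟨winNode k j, hmem k j⟩) - m k
  have hXm : ∀ k, StronglyMeasurable (X k) := fun k =>
    (hG.comp_measurable (measurable_pi_lambda _ fun j => measurable_pi_apply _)).sub
      stronglyMeasurable_const
  have hGm : ∀ k : Fin (K - M), StronglyMeasurable fun w => G (fun j => t (winNode k j) w) :=
    fun k => hG.comp_measurable (measurable_pi_lambda _ fun j => htm _)
  have hGint : ∀ k : Fin (K - M), Integrable (fun w => G (fun j => t (winNode k j) w)) P :=
    fun k => Integrable.of_bound (hGm k).aestronglyMeasurable b
      (Filter.Eventually.of_forall fun w => hGb _)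
  have hm : ∀ k, ‖m k‖ ≤ b := fun k => by
    simpa using norm_integral_le_of_norm_le_const (μ := P)
      (Filter.Eventually.of_forall fun w => hGb (fun j => t (winNode k j) w))
  have hXb : ∀ k, HasSquareExpBound P (2 * (2 * b) ^ 2) (fun w => X k (fun a => t a w)) := by
    intro k
    refine hasSquareExpBound_of_norm_le
      ((hGm k).sub stronglyMeasurable_const).aestronglyMeasurable (by positivity)
      (Filter.Eventually.of_forall fun w => ?_) ?_
    · exact (norm_sub_le _ _).trans (by linarith [hGb (fun j => t (winNode k j) w), hm k])
    · change ∫ w, (G (fun j => t (winNode k j) w) - m k) ∂P = 0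
      rw [integral_sub (hGint k) (integrable_const _)]
      simp [m]
  -- Distinct windows with congruent indices modulo `M + 1` share no node, so each residue class is
  -- a sum over disjoint blocks.
  let I : ℕ → Finset (Fin (K - M)) := fun r => Finset.univ.filter fun k => k.1 % (M + 1) = r
  have hblock : ∀ r ∈ Finset.range (M + 1),
      ∫⁻ w, ENNReal.ofReal (Real.exp (‖∑ k ∈ I r, X k (fun a => t a w)‖ ^ 2 /
        (2 * (2 * (2 * b) ^ 2) * ℓ))) ∂P ≤ ENNReal.ofReal (Real.exp 1) := by
    intro r _
    refine lintegral_exp_norm_sum_sq_le (fun a => (htm a).aemeasurable) ht s hXm (by positivity)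
      hℓ1 (I r) ?_ ?_ (fun k _ => hXb k)
    · rw [hℓ]
      exact_mod_cast (Finset.card_le_univ _).trans (by simp)
    · intro k hk l hl hkl
      rw [Finset.disjoint_left]
      intro a ha hb
      obtain ⟨j, -, hj⟩ := Finset.mem_image.1 ha
      obtain ⟨j', -, hj'⟩ := Finset.mem_image.1 hb
      have h1 : k.1 + j.1 = l.1 + j'.1 := by
        have := congrArg Fin.val (hj.trans hj'.symm)
        simpa [winNode] using this
      have h2 : k.1 % (M + 1) = l.1 % (M + 1) := by
        rw [(Finset.mem_filter.1 hk).2, (Finset.mem_filter.1 hl).2]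
      have h3 : j.1 % (M + 1) = j'.1 % (M + 1) :=
        Nat.ModEq.add_left_cancel (show k.1 ≡ l.1 [MOD M + 1] from h2)
          (show k.1 + j.1 ≡ l.1 + j'.1 [MOD M + 1] by rw [h1])
      rw [Nat.mod_eq_of_lt j.2, Nat.mod_eq_of_lt j'.2] at h3
      exact hkl (Fin.ext (by omega))
  have hsplit : ∀ w, ∑ k : Fin (K - M), X k (fun a => t a w)
      = ∑ r ∈ Finset.range (M + 1), ∑ k ∈ I r, X k (fun a => t a w) := fun w =>
    (Finset.sum_fiberwise_of_maps_to (fun k _ => Finset.mem_range.2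
      (Nat.mod_lt _ (Nat.succ_pos M))) _).symm
  calc _ = ∫⁻ w, ENNReal.ofReal (Real.exp (‖∑ k, X k (fun a => t a w)‖ ^ 2 /
        (16 * b ^ 2 * (M + 1) ^ 2 * ℓ))) ∂P := rfl
    _ ≤ ∫⁻ w, ∑ r ∈ Finset.range (M + 1), ENNReal.ofReal (Real.exp (
        ‖∑ k ∈ I r, X k (fun a => t a w)‖ ^ 2 / (2 * (2 * (2 * b) ^ 2) * ℓ))) ∂P := by
        refine lintegral_mono fun w => ?_
        -- The largest class sum controls the total up to a factor `M + 1`, whence `(M + 1)²` in the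
        -- denominator; bounding the exponential of the maximum by the sum of exponentials gives the
        -- factor `M + 1` outside.
        obtain ⟨r, hr, hmax⟩ := Finset.exists_max_image (Finset.range (M + 1))
          (fun r => ‖∑ k ∈ I r, X k (fun a => t a w)‖) ⟨0, by simp⟩
        have hle : ‖∑ k, X k (fun a => t a w)‖ ≤ (M + 1) * ‖∑ k ∈ I r, X k (fun a => t a w)‖ := by
          rw [hsplit w]
          refine (norm_sum_le_of_le _ hmax).trans ?_
          simp
        refine le_trans ?_ (Finset.single_le_sum (f := fun r => ENNReal.ofReal (Real.exp (
          ‖∑ k ∈ I r, X k (fun a => t a w)‖ ^ 2 / (2 * (2 * (2 * b) ^ 2) * ℓ))))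
          (fun _ _ => zero_le) hr)
        refine ENNReal.ofReal_le_ofReal (Real.exp_le_exp.2 ?_)
        rw [div_le_div_iff₀ (by positivity) (by positivity)]
        have := pow_le_pow_left₀ (norm_nonneg _) hle 2
        have hp : 0 ≤ 16 * b ^ 2 * ℓ := by positivity
        have := mul_le_mul_of_nonneg_right this hp
        nlinarith
    _ = ∑ r ∈ Finset.range (M + 1), ∫⁻ w, ENNReal.ofReal (Real.exp (
        ‖∑ k ∈ I r, X k (fun a => t a w)‖ ^ 2 / (2 * (2 * (2 * b) ^ 2) * ℓ))) ∂P := by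
        refine lintegral_finsetSum _ fun r _ => ?_
        have : StronglyMeasurable fun w => ∑ k ∈ I r, X k (fun a => t a w) :=
          Finset.stronglyMeasurable_fun_sum _ fun k _ =>
            (hXm k).comp_measurable (measurable_pi_lambda _ fun a => htm _)
        have := this.norm.measurable
        fun_prop
    _ ≤ ∑ r ∈ Finset.range (M + 1), ENNReal.ofReal (Real.exp 1) := Finset.sum_le_sum hblock
    _ = _ := by
        rw [Finset.sum_const, Finset.card_range, nsmul_eq_mul, ENNReal.ofReal_mul (by positivity)]
        congr 1
        rw [ENNReal.ofReal_add (by positivity) zero_le_one]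
        simp

/-- Markov's inequality for an exponential moment. -/
lemma measure_lt_le_of_lintegral_exp_le {P : Measure Ω} {Z : Ω → ℝ} (hZ : AEMeasurable Z P)
    {C η : ℝ} (hC : 0 < C) (hη : 0 < η) (h : ∫⁻ w, ENNReal.ofReal (Real.exp (Z w)) ∂P ≤ ENNReal.ofReal C) :
    P {w | Real.log (C / η) < Z w} ≤ ENNReal.ofReal η := by
  have h1 : {w | Real.log (C / η) < Z w} ⊆
      {w | ENNReal.ofReal (C / η) ≤ ENNReal.ofReal (Real.exp (Z w))} := by
    intro w hw
    refine ENNReal.ofReal_le_ofReal ?_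
    rw [← Real.log_le_iff_le_exp (by positivity)]
    exact le_of_lt hw
  have h2 := mul_meas_ge_le_lintegral₀ (μ := P)
    (f := fun w => ENNReal.ofReal (Real.exp (Z w))) (by fun_prop) (ENNReal.ofReal (C / η))
  refine (measure_mono h1).trans ?_
  have h3 := h2.trans h
  rw [show C = C / η * η by field_simp, ENNReal.ofReal_mul (by positivity)] at h3
  rw [show C / η * η / η = C / η by field_simp] at h3
  exact (ENNReal.mul_le_mul_iff_right (by simpa using by positivity) ENNReal.ofReal_ne_top).1 h3

end Concentration

/-! ### Multistep methods on admissible windows -/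

section Windows

variable {M : ℕ}

/-- The steps between consecutive nodes of a window. -/
def nodeSteps (s : Fin (M + 1) → ℝ) (i : Fin M) : ℝ := s i.succ - s i.castSucc

/-- The set of admissible grids. -/
def admissibleSet (K : ℕ) (hmax ω : ℝ) : Set (Fin K → ℝ) := {s | AdmissibleGrid hmax ω s}

lemma measurableSet_admissibleSet (K : ℕ) (hmax ω : ℝ) :
    MeasurableSet (admissibleSet K hmax ω) := by
  have e : admissibleSet K hmax ω = {s | (∀ i, 0 ≤ s i) ∧
      (∀ i j : Fin K, i.1 + 1 = j.1 → s i < s j) ∧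
      (∀ i j : Fin K, i.1 + 1 = j.1 → s j - s i ≤ hmax) ∧
      ∀ i j l : Fin K, i.1 + 1 = j.1 → j.1 + 1 = l.1 →
        s l - s j ≤ ω * (s j - s i) ∧ s j - s i ≤ ω * (s l - s j)} := by
    ext s
    exact ⟨fun h => ⟨h.1, h.2, h.3, h.4⟩, fun h => ⟨h.1, h.2.1, h.2.2.1, h.2.2.2⟩⟩
  rw [e]
  simp only [Set.ofPred_and, Set.ofPred_forall]
  refine MeasurableSet.inter ?_ (MeasurableSet.inter ?_ (MeasurableSet.inter ?_ ?_))
  · exact MeasurableSet.iInter fun i => measurableSet_le (by fun_prop) (by fun_prop)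
  · exact MeasurableSet.iInter fun i => MeasurableSet.iInter fun j => MeasurableSet.iInter fun _ =>
      measurableSet_lt (by fun_prop) (by fun_prop)
  · exact MeasurableSet.iInter fun i => MeasurableSet.iInter fun j => MeasurableSet.iInter fun _ =>
      measurableSet_le (by fun_prop) (by fun_prop)
  · exact MeasurableSet.iInter fun i => MeasurableSet.iInter fun j => MeasurableSet.iInter fun l =>
      MeasurableSet.iInter fun _ => MeasurableSet.iInter fun _ =>
        (measurableSet_le (by fun_prop) (by fun_prop)).inter
          (measurableSet_le (by fun_prop) (by fun_prop))

lemma AdmissibleGrid.window {K : ℕ} {hmax ω : ℝ} {t : Fin K → ℝ} (ht : AdmissibleGrid hmax ω t)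
    (k : Fin (K - M)) : AdmissibleGrid hmax ω (fun j : Fin (M + 1) => t (winNode k j)) where
  nonneg i := ht.nonneg _
  step_pos i j h := ht.step_pos _ _ (by simp only [winNode]; omega)
  step_le i j h := ht.step_le _ _ (by simp only [winNode]; omega)
  ratio i j l h h' := ht.ratio _ _ _ (by simp only [winNode]; omega) (by simp only [winNode]; omega)

variable {hmax ω : ℝ} {s : Fin (M + 1) → ℝ}

lemma AdmissibleGrid.nodeSteps_pos (hs : AdmissibleGrid hmax ω s) (i : Fin M) :
    0 < nodeSteps s i :=
  sub_pos.2 (hs.step_pos _ _ (by simp))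

lemma AdmissibleGrid.nodeSteps_le (hs : AdmissibleGrid hmax ω s) (i : Fin M) :
    nodeSteps s i ≤ hmax :=
  hs.step_le _ _ (by simp)

/-- Chain the ratio bounds. Replacing `ω` by `max ω 1` makes its powers increasing, so that one
exponent `M` serves every step. -/
lemma AdmissibleGrid.nodeSteps_comparable [NeZero M] (hs : AdmissibleGrid hmax ω s) (i : Fin M) :
    nodeSteps s i ≤ max ω 1 ^ M * nodeSteps s 0 ∧ nodeSteps s 0 ≤ max ω 1 ^ M * nodeSteps s i := by
  have h1 : (1 : ℝ) ≤ max ω 1 := le_max_right _ _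
  have key : ∀ q : ℕ, ∀ hq : q < M, nodeSteps s ⟨q, hq⟩ ≤ max ω 1 ^ q * nodeSteps s 0 ∧
      nodeSteps s 0 ≤ max ω 1 ^ q * nodeSteps s ⟨q, hq⟩ := by
    intro q
    induction q with
    | zero => intro hq; simp [show (⟨0, hq⟩ : Fin M) = 0 from rfl]
    | succ q ih =>
      intro hq
      obtain ⟨ih1, ih2⟩ := ih (by omega)
      have hr := hs.ratio (Fin.castSucc ⟨q, by omega⟩) (Fin.castSucc ⟨q + 1, hq⟩)
        (Fin.succ ⟨q + 1, hq⟩) (by simp) (by simp)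
      have e1 : s (Fin.succ ⟨q + 1, hq⟩) - s (Fin.castSucc ⟨q + 1, hq⟩)
        = nodeSteps s ⟨q + 1, hq⟩ := rfl
      have e2 : s (Fin.castSucc ⟨q + 1, hq⟩) - s (Fin.castSucc ⟨q, by omega⟩)
        = nodeSteps s ⟨q, by omega⟩ := rfl
      rw [e1, e2] at hr
      have p0 := hs.nodeSteps_pos ⟨q, by omega⟩
      have p1 := hs.nodeSteps_pos ⟨q + 1, hq⟩
      constructor
      · calc nodeSteps s ⟨q + 1, hq⟩ ≤ ω * nodeSteps s ⟨q, by omega⟩ := hr.1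
          _ ≤ max ω 1 * nodeSteps s ⟨q, by omega⟩ := by gcongr; exact le_max_left _ _
          _ ≤ max ω 1 * (max ω 1 ^ q * nodeSteps s 0) := by gcongr
          _ = _ := by ring
      · calc nodeSteps s 0 ≤ max ω 1 ^ q * nodeSteps s ⟨q, by omega⟩ := ih2
          _ ≤ max ω 1 ^ q * (ω * nodeSteps s ⟨q + 1, hq⟩) := by gcongr; exact hr.2
          _ ≤ max ω 1 ^ q * (max ω 1 * nodeSteps s ⟨q + 1, hq⟩) := by
            gcongr; exact le_max_left _ _
          _ = _ := by ring
  obtain ⟨k1, k2⟩ := key i.1 i.2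
  have hpow : max ω 1 ^ i.1 ≤ max ω 1 ^ M := pow_le_pow_right₀ h1 i.2.le
  have p0 := hs.nodeSteps_pos 0
  have pi := hs.nodeSteps_pos i
  exact ⟨k1.trans (by gcongr), k2.trans (by gcongr)⟩

lemma nodeOffset_nodeSteps (s : Fin (M + 1) → ℝ) (j : Fin (M + 1)) :
    nodeOffset (nodeSteps s) j = s j - s 0 := by
  induction j using Fin.induction with
  | zero => simp [nodeOffset]
  | succ j ih =>
    have e : nodeOffset (nodeSteps s) j.succ = nodeOffset (nodeSteps s) j.castSucc
        + nodeSteps s j := by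
      have h : ∀ i : Fin M, (if i.castSucc < j.succ then nodeSteps s i else 0)
          = (if i.castSucc < j.castSucc then nodeSteps s i else 0)
            + if i = j then nodeSteps s i else 0 := by
        intro i
        rcases lt_trichotomy i j with h | h | h
        · have h1 : i.castSucc < j.succ := by
            rw [Fin.lt_def] at h ⊢; simp; omega
          simp [h1, h, h.ne]
        · subst h; simp
        · have h1 : ¬ i.castSucc < j.succ := by
            rw [Fin.lt_def] at h ⊢; simp; omega
          simp [h1, h.ne', h.le]
      simp only [nodeOffset, h, Finset.sum_add_distrib, Finset.sum_ite_eq', Finset.mem_univ,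
        if_true]
    rw [e, ih, nodeSteps]
    ring

lemma AdmissibleGrid.offset_bounds [NeZero M] (hs : AdmissibleGrid hmax ω s) (j : Fin (M + 1)) :
    0 ≤ s j - s 0 ∧ s j - s 0 ≤ M * max ω 1 ^ M * nodeSteps s 0 := by
  rw [← nodeOffset_nodeSteps, nodeOffset]
  constructor
  · refine Finset.sum_nonneg fun i _ => ?_
    split_ifs
    exacts [(hs.nodeSteps_pos i).le, le_rfl]
  · have p0 := hs.nodeSteps_pos 0
    calc _ ≤ ∑ _i : Fin M, max ω 1 ^ M * nodeSteps s 0 := by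
          refine Finset.sum_le_sum fun i _ => ?_
          split_ifs
          exacts [(hs.nodeSteps_comparable i).1, by positivity]
      _ = _ := by simp; ring

/-- On admissible windows the coefficients `aⱼ` are bounded and the `bⱼ` are of the order of the
step size. -/
lemma VLMM.exists_coeff_bound [NeZero M] (meth : VLMM M) (hmax ω : ℝ) :
    ∃ C : ℝ, 0 < C ∧ ∀ s : Fin (M + 1) → ℝ, AdmissibleGrid hmax ω s → ∀ j,
      |meth.a (nodeSteps s) j| ≤ C ∧ |meth.b (nodeSteps s) j| ≤ C * nodeSteps s 0 := by
  set W : ℝ := max ω 1 ^ M with hW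
  have hWpos : 0 < W := by positivity
  let box : Set (Fin M → ℝ) := Set.Icc (fun _ => W⁻¹) (fun _ => W)
  have hsub : box ⊆ {h | ∀ i, 0 < h i} := fun h hh i => (inv_pos.2 hWpos).trans_le (hh.1 i)
  obtain ⟨Ca, hCa⟩ := isCompact_Icc.exists_bound_of_continuousOn (meth.a_cont.mono hsub)
  obtain ⟨Cb, hCb⟩ := isCompact_Icc.exists_bound_of_continuousOn (meth.b_cont.mono hsub)
  refine ⟨max (max Ca Cb) 1, by positivity, fun s hs j => ?_⟩
  have p0 := hs.nodeSteps_pos 0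
  set h := nodeSteps s 0 with hh
  -- After division by the first step the window lies in a compact box of positive vectors, where
  -- the continuous coefficients are bounded; homogeneity transports the bounds back.
  let g : Fin M → ℝ := h⁻¹ • nodeSteps s
  have hg : g ∈ box := by
    constructor <;> intro i
    · simp only [g, Pi.smul_apply, smul_eq_mul]
      rw [inv_le_iff_one_le_mul₀ hWpos, mul_comm, ← mul_assoc, mul_comm W, mul_assoc,
        ← div_eq_inv_mul, one_le_div p0]
      exact (hs.nodeSteps_comparable i).2
    · simp only [g, Pi.smul_apply, smul_eq_mul]
      rw [inv_mul_le_iff₀ p0, mul_comm]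
      exact (hs.nodeSteps_comparable i).1
  have e : nodeSteps s = h • g := by simp [g, smul_smul, p0.ne']
  rw [e, meth.a_scale h g p0 (hsub hg), meth.b_scale h g p0 (hsub hg)]
  constructor
  · exact (norm_le_pi_norm (meth.a g) j).trans
      ((hCa g hg).trans ((le_max_left _ _).trans (le_max_left _ _)))
  · rw [Pi.smul_apply, smul_eq_mul, abs_mul, abs_of_pos p0, mul_comm]
    gcongr
    exact (norm_le_pi_norm (meth.b g) j).trans
      ((hCb g hg).trans ((le_max_right _ _).trans (le_max_left _ _)))

lemma continuous_nodeSteps : Continuous (nodeSteps : (Fin (M + 1) → ℝ) → Fin M → ℝ) := by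
  unfold nodeSteps
  fun_prop

lemma VLMM.continuousOn_a (meth : VLMM M) (j : Fin (M + 1)) :
    ContinuousOn (fun s => meth.a (nodeSteps s) j) (admissibleSet (M + 1) hmax ω) :=
  (continuous_apply j).comp_continuousOn
    (meth.a_cont.comp continuous_nodeSteps.continuousOn fun _ hs i =>
      AdmissibleGrid.nodeSteps_pos hs i)

lemma VLMM.continuousOn_b (meth : VLMM M) (j : Fin (M + 1)) :
    ContinuousOn (fun s => meth.b (nodeSteps s) j) (admissibleSet (M + 1) hmax ω) :=
  (continuous_apply j).comp_continuousOn
    (meth.b_cont.comp continuous_nodeSteps.continuousOn fun _ hs i =>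
      AdmissibleGrid.nodeSteps_pos hs i)

end Windows

/-! ### Truncation error -/

section Truncation

variable {E : Type*} [NormedAddCommGroup E] [NormedSpace ℝ E]

lemma norm_sub_taylor_le {f : ℝ → E} {q : ℕ} {D : ℝ}
    (hf : ContDiffOn ℝ ((q + 1 : ℕ) : WithTop ℕ∞) f (Set.Ici 0))
    (hD : ∀ t, 0 ≤ t → ‖iteratedDerivWithin (q + 1) f (Set.Ici 0) t‖ ≤ D) {a b : ℝ} (ha : 0 ≤ a)
    (hab : a ≤ b) :
    ‖f b - ∑ i ∈ Finset.range (q + 1),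
      ((i.factorial : ℝ)⁻¹ * (b - a) ^ i) • iteratedDerivWithin i f (Set.Ici 0) a‖
      ≤ D * (b - a) ^ (q + 1) := by
  have hD0 : 0 ≤ D := (norm_nonneg _).trans (hD 0 le_rfl)
  -- The interval is lengthened to `b + 1` so that it is nondegenerate, with unique derivatives,
  -- even for `a = b`.
  have hsub : Set.Icc a (b + 1) ⊆ Set.Ici 0 := fun y hy => ha.trans hy.1
  have hlt : a < b + 1 := by linarith
  have hd : ∀ i ≤ q + 1, ∀ y ∈ Set.Icc a (b + 1),
      iteratedDerivWithin i f (Set.Icc a (b + 1)) y = iteratedDerivWithin i f (Set.Ici 0) y := by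
    intro i hi y hy
    rw [iteratedDerivWithin, iteratedDerivWithin, iteratedFDerivWithin_subset hsub
      (uniqueDiffOn_Icc hlt) (uniqueDiffOn_Ici 0) (hf.of_le (by exact_mod_cast hi)) hy]
  have h := taylor_mean_remainder_bound (n := q) hlt.le
    (by exact_mod_cast hf.mono hsub) (show b ∈ Set.Icc a (b + 1) from ⟨hab, by linarith⟩)
    (C := D) (fun y hy => by rw [hd _ le_rfl y hy]; exact hD y (hsub hy))
  rw [taylor_within_apply] at h
  have e : ∀ i ∈ Finset.range (q + 1), ((i.factorial : ℝ)⁻¹ * (b - a) ^ i) •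
      iteratedDerivWithin i f (Set.Icc a (b + 1)) a = ((i.factorial : ℝ)⁻¹ * (b - a) ^ i) •
      iteratedDerivWithin i f (Set.Ici 0) a := fun i hi => by
    rw [hd i (Finset.mem_range.1 hi).le a ⟨le_rfl, hlt.le⟩]
  rw [Finset.sum_congr rfl e] at h
  refine h.trans (div_le_self ?_ ?_)
  · have : 0 ≤ b - a := by linarith
    positivity
  · exact_mod_cast Nat.factorial_pos q

lemma norm_deriv_sub_taylor_le {f : ℝ → E} {p : ℕ} {D : ℝ}
    (hf : ContDiffOn ℝ ((p + 1 : ℕ) : WithTop ℕ∞) f (Set.Ici 0))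
    (hD : ∀ t, 0 ≤ t → ‖iteratedDerivWithin (p + 1) f (Set.Ici 0) t‖ ≤ D) {a b : ℝ} (ha : 0 ≤ a)
    (hab : a ≤ b) :
    ‖derivWithin f (Set.Ici 0) b - ∑ i ∈ Finset.range p,
      ((i.factorial : ℝ)⁻¹ * (b - a) ^ i) • iteratedDerivWithin (i + 1) f (Set.Ici 0) a‖
      ≤ D * (b - a) ^ p := by
  cases p with
  | zero =>
    have := hD b (ha.trans hab)
    rw [zero_add, iteratedDerivWithin_one] at this
    simpa using this
  | succ q =>
    have hf' : ContDiffOn ℝ ((q + 1 : ℕ) : WithTop ℕ∞) (derivWithin f (Set.Ici 0)) (Set.Ici 0) :=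
      hf.derivWithin (uniqueDiffOn_Ici 0) (by norm_cast)
    have e : ∀ i, ∀ t, 0 ≤ t → iteratedDerivWithin i (derivWithin f (Set.Ici 0)) (Set.Ici 0) t
        = iteratedDerivWithin (i + 1) f (Set.Ici 0) t := fun i t ht => by
      rw [iteratedDerivWithin_succ']
    have := norm_sub_taylor_le hf' (fun t ht => by rw [e _ t ht]; exact hD t ht) ha hab
    simpa only [e _ a ha] using this

lemma VLMM.HasOrder.sum_a {M p : ℕ} {meth : VLMM M} (hp : meth.HasOrder p) {h : Fin M → ℝ}
    (hh : ∀ i, 0 < h i) : ∑ j, meth.a h j = 0 := by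
  simpa using hp h hh 1 (by simp)

lemma VLMM.HasOrder.sum_moment {M p : ℕ} {meth : VLMM M} (hp : meth.HasOrder p) {h : Fin M → ℝ}
    (hh : ∀ i, 0 < h i) {i : ℕ} (hi : i < p) :
    ∑ j, meth.a h j * (((i + 1).factorial : ℝ)⁻¹ * nodeOffset h j ^ (i + 1))
      = ∑ j, meth.b h j * ((i.factorial : ℝ)⁻¹ * nodeOffset h j ^ i) := by
  have := hp h hh (Polynomial.C ((i + 1).factorial : ℝ)⁻¹ * Polynomial.X ^ (i + 1))
    ((Polynomial.natDegree_C_mul_X_pow_le _ _).trans hi)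
  simp only [Polynomial.eval_mul, Polynomial.eval_C, Polynomial.eval_pow, Polynomial.eval_X,
    Polynomial.derivative_C_mul_X_pow, Nat.add_sub_cancel] at this
  rw [this]
  refine Finset.sum_congr rfl fun j _ => ?_
  rw [Nat.factorial_succ]
  have : (i.factorial : ℝ) ≠ 0 := by positivity
  push_cast
  field_simp

/-- The truncation error of a method of order `p` on an admissible window is `O(h^{p+1})`. -/
lemma VLMM.exists_truncation_bound {M p : ℕ} [NeZero M] {meth : VLMM M} (hp : meth.HasOrder p)
    (hmax ω : ℝ) {f : ℝ → E} {D : ℝ}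
    (hf : ContDiffOn ℝ ((p + 1 : ℕ) : WithTop ℕ∞) f (Set.Ici 0))
    (hD : ∀ t, 0 ≤ t → ‖iteratedDerivWithin (p + 1) f (Set.Ici 0) t‖ ≤ D) :
    ∃ C : ℝ, 0 < C ∧ ∀ s : Fin (M + 1) → ℝ, AdmissibleGrid hmax ω s →
      ‖∑ j, meth.a (nodeSteps s) j • f (s j)
        - ∑ j, meth.b (nodeSteps s) j • derivWithin f (Set.Ici 0) (s j)‖
        ≤ C * nodeSteps s 0 ^ (p + 1) := by
  obtain ⟨C, hC, hbd⟩ := meth.exists_coeff_bound hmax ω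
  have hD0 : 0 ≤ D := (norm_nonneg _).trans (hD 0 le_rfl)
  set c : ℝ := M * max ω 1 ^ M with hc
  have hc0 : 0 ≤ c := by positivity
  refine ⟨(M + 1) * (C * (D * c ^ (p + 1)) + C * (D * c ^ p)) + 1, by positivity, fun s hs => ?_⟩
  have p0 := hs.nodeSteps_pos 0
  set h := nodeSteps s 0 with hh
  set a := meth.a (nodeSteps s) with ha
  set b := meth.b (nodeSteps s) with hb
  let Tf : Fin (M + 1) → E := fun j => ∑ i ∈ Finset.range (p + 1),
      ((i.factorial : ℝ)⁻¹ * (s j - s 0) ^ i) • iteratedDerivWithin i f (Set.Ici 0) (s 0)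
  let Td : Fin (M + 1) → E := fun j => ∑ i ∈ Finset.range p,
      ((i.factorial : ℝ)⁻¹ * (s j - s 0) ^ i) • iteratedDerivWithin (i + 1) f (Set.Ici 0) (s 0)
  -- The method is exact on the Taylor polynomial at the first node, so only remainders survive:
  -- bounded `a` times `O(h^(p+1))`, and `b` of order `h` times `O(h^p)`.
  have hT : ∑ j, a j • Tf j = ∑ j, b j • Td j := by
    have sw : ∀ (q : ℕ) (α : Fin (M + 1) → ℝ) (g : ℕ → E) (c : ℕ → Fin (M + 1) → ℝ),
        ∑ j, α j • ∑ i ∈ Finset.range q, c i j • g i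
          = ∑ i ∈ Finset.range q, (∑ j, α j * c i j) • g i := by
      intro q α g c
      simp only [Finset.smul_sum, Finset.sum_smul, smul_smul]
      exact Finset.sum_comm
    simp only [Tf, Td]
    rw [sw (p + 1) a (fun i => iteratedDerivWithin i f (Set.Ici 0) (s 0))
      (fun i j => (i.factorial : ℝ)⁻¹ * (s j - s 0) ^ i),
      sw p b (fun i => iteratedDerivWithin (i + 1) f (Set.Ici 0) (s 0))
      (fun i j => (i.factorial : ℝ)⁻¹ * (s j - s 0) ^ i), Finset.sum_range_succ']
    have h0 : ∑ j, a j * (((Nat.factorial 0 : ℕ) : ℝ)⁻¹ * (s j - s 0) ^ 0) = 0 := by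
      simpa using hp.sum_a hs.nodeSteps_pos
    rw [h0, zero_smul, add_zero]
    refine Finset.sum_congr rfl fun i hi => ?_
    have := hp.sum_moment hs.nodeSteps_pos (Finset.mem_range.1 hi)
    simp only [nodeOffset_nodeSteps] at this
    rw [this]
  have hR : ∀ j, ‖a j • (f (s j) - Tf j)‖ ≤ C * (D * c ^ (p + 1)) * h ^ (p + 1) := by
    intro j
    obtain ⟨o1, o2⟩ := hs.offset_bounds j
    have h1 := norm_sub_taylor_le hf hD (hs.nonneg 0) (sub_nonneg.1 o1)
    rw [norm_smul, Real.norm_eq_abs]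
    calc _ ≤ C * (D * (s j - s 0) ^ (p + 1)) :=
          mul_le_mul (hbd s hs j).1 h1 (norm_nonneg _) hC.le
      _ ≤ C * (D * (c * h) ^ (p + 1)) := by gcongr
      _ = _ := by rw [mul_pow]; ring
  have hR' : ∀ j, ‖b j • (derivWithin f (Set.Ici 0) (s j) - Td j)‖
      ≤ C * (D * c ^ p) * h ^ (p + 1) := by
    intro j
    obtain ⟨o1, o2⟩ := hs.offset_bounds j
    have h1 := norm_deriv_sub_taylor_le hf hD (hs.nonneg 0) (sub_nonneg.1 o1)
    rw [norm_smul, Real.norm_eq_abs]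
    calc _ ≤ (C * h) * (D * (s j - s 0) ^ p) :=
          mul_le_mul (hbd s hs j).2 h1 (norm_nonneg _) (by positivity)
      _ ≤ (C * h) * (D * (c * h) ^ p) := by gcongr
      _ = _ := by rw [mul_pow]; ring
  have e : ∑ j, a j • f (s j) - ∑ j, b j • derivWithin f (Set.Ici 0) (s j)
      = ∑ j, a j • (f (s j) - Tf j) - ∑ j, b j • (derivWithin f (Set.Ici 0) (s j) - Td j) := by
    simp only [smul_sub, Finset.sum_sub_distrib, hT]
    abel
  rw [e]
  refine (norm_sub_le _ _).trans ((add_le_add (norm_sum_le_of_le _ fun j _ => hR j)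
    (norm_sum_le_of_le _ fun j _ => hR' j)).trans ?_)
  simp only [Finset.sum_const, Finset.card_univ, Fintype.card_fin, nsmul_eq_mul]
  have : 0 < h ^ (p + 1) := by positivity
  push_cast
  nlinarith

end Truncation

/-! ### Representers of the port-Hamiltonian field values -/

section Representers

variable {n m : ℕ} (𝓗 : Type*) [NormedAddCommGroup 𝓗] [InnerProductSpace ℝ 𝓗] [CompleteSpace 𝓗]
  [RKHS ℝ 𝓗 (State n) ℝ]

/-- The canonical feature map of the base kernel. -/
def feature (z : State n) : 𝓗 := RKHS.kerFun 𝓗 z 1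

lemma inner_feature (x y : State n) :
    inner ℝ (feature 𝓗 x) (feature 𝓗 y) = baseKernel 𝓗 x y := by
  have := RKHS.kernel_inner 𝓗 x y (1 : ℝ) (1 : ℝ)
  rw [real_inner_comm, feature, feature, ← this, baseKernel]
  simp

lemma inner_feature_left (z : State n) (g : 𝓗) : inner ℝ (feature 𝓗 z) g = g z := by
  rw [feature, RKHS.kerFun_inner]
  simp

lemma contDiff_inner_feature
    (hk : ContDiff ℝ 2 fun z : State n × State n => baseKernel 𝓗 z.1 z.2) :
    ContDiff ℝ 2 fun p : State n × State n => inner ℝ (feature 𝓗 p.1) (feature 𝓗 p.2) := by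
  simpa only [inner_feature] using hk

/-- The representer of `g ↦ (J_R(z) ∇g(z))_c`. -/
def fieldRep (S : PortHamiltonian n m) (z : State n) (c : Fin n) : 𝓗 :=
  ∑ i, S.JR z c i • fderiv ℝ (feature 𝓗) z (EuclideanSpace.single i 1)

variable {𝓗}

/-- Differentiate the reproducing identity `g z = ⟪g, Φ z⟫`. -/
lemma gradient_apply_eq_inner
    (hk : ContDiff ℝ 2 fun z : State n × State n => baseKernel 𝓗 z.1 z.2) (g : 𝓗) (z : State n)
    (i : Fin n) : (∇ (g : State n → ℝ) z) i
      = inner ℝ (fderiv ℝ (feature 𝓗) z (EuclideanSpace.single i 1)) g := by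
  have hΦ := differentiable_of_contDiff_inner (contDiff_inner_feature 𝓗 hk)
  have e : (g : State n → ℝ) = fun z' => inner ℝ g (feature 𝓗 z') := by
    funext z'
    rw [real_inner_comm, inner_feature_left]
  have h := (hasFDerivAt_inner_right hΦ g z).fderiv
  rw [← e] at h
  have h2 : inner ℝ (∇ (g : State n → ℝ) z) (EuclideanSpace.single i 1)
      = fderiv ℝ (g : State n → ℝ) z (EuclideanSpace.single i 1) := by
    rw [gradient, InnerProductSpace.toDual_symm_apply]
  rw [EuclideanSpace.inner_single_right] at h2
  simp only [one_mul, conj_trivial] at h2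
  rw [h2, h, ContinuousLinearMap.comp_apply, innerSL_apply_apply, real_inner_comm]

lemma field_apply (hk : ContDiff ℝ 2 fun z : State n × State n => baseKernel 𝓗 z.1 z.2)
    (S : PortHamiltonian n m) (g : 𝓗) (z : State n) (c : Fin n) :
    S.field (g : State n → ℝ) z c = inner ℝ (fieldRep 𝓗 S z c) g := by
  simp only [PortHamiltonian.field, Matrix.mulVec, dotProduct, fieldRep, sum_inner,
    real_inner_smul_left]
  exact Finset.sum_congr rfl fun i _ => by rw [← gradient_apply_eq_inner hk g z i]

lemma field_sub (hk : ContDiff ℝ 2 fun z : State n × State n => baseKernel 𝓗 z.1 z.2)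
    (S : PortHamiltonian n m) (g g' : 𝓗) :
    S.field (⇑(g - g') : State n → ℝ) = S.field (g : State n → ℝ) - S.field (g' : State n → ℝ) := by
  funext z
  ext c
  simp only [Pi.sub_apply, PiLp.sub_apply, field_apply hk, inner_sub_right]

lemma mixedHessian_baseKernel
    (hk : ContDiff ℝ 2 fun z : State n × State n => baseKernel 𝓗 z.1 z.2) (x y : State n)
    (i j : Fin n) : mixedHessian (baseKernel 𝓗) x y i j
      = inner ℝ (fderiv ℝ (feature 𝓗) x (EuclideanSpace.single i 1))
          (fderiv ℝ (feature 𝓗) y (EuclideanSpace.single j 1)) := by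
  have hΦ := differentiable_of_contDiff_inner (contDiff_inner_feature 𝓗 hk)
  simp only [mixedHessian, Matrix.of_apply, ← inner_feature]
  have e : ∀ x', fderiv ℝ (fun y' => inner ℝ (feature 𝓗 x') (feature 𝓗 y')) y
      (EuclideanSpace.single j 1)
      = inner ℝ (fderiv ℝ (feature 𝓗) y (EuclideanSpace.single j 1)) (feature 𝓗 x') := by
    intro x'
    rw [(hasFDerivAt_inner_right hΦ (feature 𝓗 x') y).fderiv, ContinuousLinearMap.comp_apply,
      innerSL_apply_apply, real_inner_comm]
  simp only [e]
  rw [(hasFDerivAt_inner_right hΦ _ x).fderiv, ContinuousLinearMap.comp_apply,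
      innerSL_apply_apply, real_inner_comm]

/-- The vectors `fieldRep` thus serve as a feature map for the matrix kernel, so vector-valued
regression becomes ridge regression in `𝓗` itself. -/
lemma phsKernel_apply (hk : ContDiff ℝ 2 fun z : State n × State n => baseKernel 𝓗 z.1 z.2)
    (S : PortHamiltonian n m) (σf : ℝ) (x y : State n) (c c' : Fin n) :
    phsKernel S (baseKernel 𝓗) σf x y c c'
      = σf ^ 2 * inner ℝ (fieldRep 𝓗 S x c) (fieldRep 𝓗 S y c') := by
  simp only [phsKernel, Matrix.smul_apply, smul_eq_mul, Matrix.mul_apply, Matrix.transpose_apply,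
    mixedHessian_baseKernel hk, fieldRep, sum_inner, inner_sum, real_inner_smul_left,
    real_inner_smul_right, Finset.sum_mul, Finset.mul_sum]
  exact Finset.sum_congr rfl fun i _ => Finset.sum_congr rfl fun j _ => by ring

lemma trace_phsKernel (hk : ContDiff ℝ 2 fun z : State n × State n => baseKernel 𝓗 z.1 z.2)
    (S : PortHamiltonian n m) (σf : ℝ) (z : State n) :
    (phsKernel S (baseKernel 𝓗) σf z z).trace = σf ^ 2 * ∑ c, ‖fieldRep 𝓗 S z c‖ ^ 2 := by
  simp only [Matrix.trace, Matrix.diag_apply, phsKernel_apply hk, real_inner_self_eq_norm_sq,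
    Finset.mul_sum]

lemma continuous_fieldRep (hk : ContDiff ℝ 2 fun z : State n × State n => baseKernel 𝓗 z.1 z.2)
    (S : PortHamiltonian n m) (c : Fin n) : Continuous fun z => fieldRep 𝓗 S z c := by
  refine continuous_finsetSum _ fun i _ => Continuous.smul ?_
    (continuous_fderiv_apply (contDiff_inner_feature 𝓗 hk) _)
  have : Continuous S.JR := S.J_cont.sub S.R_cont
  exact this.matrix_elem c i

lemma norm_field_sq_le (hk : ContDiff ℝ 2 fun z : State n × State n => baseKernel 𝓗 z.1 z.2)
    (S : PortHamiltonian n m) {σf : ℝ} (hσf : 0 < σf) (g : 𝓗) (z : State n) :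
    ‖S.field (g : State n → ℝ) z‖ ^ 2
      ≤ ‖g‖ ^ 2 / σf ^ 2 * (phsKernel S (baseKernel 𝓗) σf z z).trace := by
  rw [trace_phsKernel hk, EuclideanSpace.norm_sq_eq, ← mul_assoc,
    div_mul_cancel₀ _ (by positivity), Finset.mul_sum]
  refine Finset.sum_le_sum fun c _ => ?_
  rw [field_apply hk, Real.norm_eq_abs, ← mul_pow, mul_comm]
  exact pow_le_pow_left₀ (abs_nonneg _) (abs_real_inner_le_norm _ _) 2

end Representers

/-! ### Coefficient matrices -/

section Coefficients

variable {K M n : ℕ}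

lemma sum_matA_smul {V : Type*} [AddCommGroup V] [Module ℝ V] (meth : VLMM M) (t : Fin K → ℝ)
    (k : Fin (K - M)) (v : Fin K → V) : ∑ i, matA meth t k i • v i
      = ∑ j, meth.a (nodeSteps fun j => t (winNode k j)) j • v (winNode k j) := by
  simp only [matA, Matrix.of_apply, Finset.sum_smul]
  rw [Finset.sum_comm]
  refine Finset.sum_congr rfl fun j _ => ?_
  simp only [ite_smul, zero_smul, Finset.sum_ite_eq, Finset.mem_univ, if_true]
  rfl

lemma sum_matB_smul {V : Type*} [AddCommGroup V] [Module ℝ V] (meth : VLMM M) (t : Fin K → ℝ)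
    (k : Fin (K - M)) (v : Fin K → V) : ∑ i, matB meth t k i • v i
      = ∑ j, meth.b (nodeSteps fun j => t (winNode k j)) j • v (winNode k j) := by
  simp only [matB, Matrix.of_apply, Finset.sum_smul]
  rw [Finset.sum_comm]
  refine Finset.sum_congr rfl fun j _ => ?_
  simp only [ite_smul, zero_smul, Finset.sum_ite_eq, Finset.mem_univ, if_true]
  rfl

lemma sum_kronecker_one_mul {ι κ : Type*} [Fintype κ] (A : Matrix ι κ ℝ) (q : ι × Fin n)
    (f : κ × Fin n → ℝ) :
    ∑ r, (A ⊗ₖ (1 : Matrix (Fin n) (Fin n) ℝ)) q r * f r = ∑ i, A q.1 i * f (i, q.2) := by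
  rw [Fintype.sum_prod_type]
  refine Finset.sum_congr rfl fun i _ => ?_
  simp [Matrix.kroneckerMap_apply, Matrix.one_apply]

end Coefficients

/-! ### The estimator as a regularized least squares solution -/

section Estimator

variable {n m K M : ℕ} (𝓗 : Type*) [NormedAddCommGroup 𝓗] [InnerProductSpace ℝ 𝓗]
  [CompleteSpace 𝓗] [RKHS ℝ 𝓗 (State n) ℝ]

/-- The representer of component `c` of the multistep combination of field values on a window. -/
def windowRep (S : PortHamiltonian n m) (meth : VLMM M) (x : ℝ → State n) (c : Fin n)
    (s : Fin (M + 1) → ℝ) : 𝓗 :=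
  ∑ j, meth.b (nodeSteps s) j • fieldRep 𝓗 S (x (s j)) c

/-- The representer of component `c` of the multistep combination in window `k` of a grid. -/
def gridRep (S : PortHamiltonian n m) (meth : VLMM M) (x : ℝ → State n) (t : Fin K → ℝ)
    (q : Fin (K - M) × Fin n) : 𝓗 :=
  windowRep 𝓗 S meth x q.2 fun j => t (winNode q.1 j)

/-- The vector multiplying a measurement error in the normal equations. -/
def noiseRep (S : PortHamiltonian n m) (meth : VLMM M) (x : ℝ → State n) (t : Fin K → ℝ)
    (q : Fin K × Fin n) : 𝓗 :=
  ∑ k, matA meth t k q.1 • gridRep 𝓗 S meth x t (k, q.2)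

variable {𝓗}

lemma gridRep_eq (S : PortHamiltonian n m) (meth : VLMM M) (x : ℝ → State n) (t : Fin K → ℝ)
    (q : Fin (K - M) × Fin n) :
    gridRep 𝓗 S meth x t q = ∑ i, matB meth t q.1 i • fieldRep 𝓗 S (x (t i)) q.2 := by
  rw [sum_matB_smul]; rfl

lemma inner_gridRep (hk : ContDiff ℝ 2 fun z : State n × State n => baseKernel 𝓗 z.1 z.2)
    (S : PortHamiltonian n m) (meth : VLMM M) (x : ℝ → State n) (t : Fin K → ℝ)
    (k : Fin (K - M)) (c : Fin n) (g : 𝓗) :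
    inner ℝ (gridRep 𝓗 S meth x t (k, c)) g
      = (∑ i, matB meth t k i • S.field (g : State n → ℝ) (x (t i))) c := by
  simp only [gridRep_eq, sum_inner, real_inner_smul_left, WithLp.ofLp_sum, Finset.sum_apply,
    PiLp.smul_apply, smul_eq_mul, field_apply hk]

lemma norm_sum_matB_field_sq
    (hk : ContDiff ℝ 2 fun z : State n × State n => baseKernel 𝓗 z.1 z.2)
    (S : PortHamiltonian n m) (meth : VLMM M) (x : ℝ → State n) (t : Fin K → ℝ)
    (k : Fin (K - M)) (g : 𝓗) :
    ‖∑ i, matB meth t k i • S.field (g : State n → ℝ) (x (t i))‖ ^ 2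
      = ∑ c, inner ℝ (gridRep 𝓗 S meth x t (k, c)) g ^ 2 := by
  rw [EuclideanSpace.norm_sq_eq]
  exact Finset.sum_congr rfl fun c _ => by rw [inner_gridRep hk, Real.norm_eq_abs, sq_abs]

lemma gramY_apply (hk : ContDiff ℝ 2 fun z : State n × State n => baseKernel 𝓗 z.1 z.2)
    (S : PortHamiltonian n m) (meth : VLMM M) (x : ℝ → State n) (σf : ℝ) (t : Fin K → ℝ)
    (q r : Fin (K - M) × Fin n) :
    gramY (phsKernel S (baseKernel 𝓗) σf) meth x t q r
      = σf ^ 2 * inner ℝ (gridRep 𝓗 S meth x t q) (gridRep 𝓗 S meth x t r) := by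
  simp only [gramY, Matrix.mul_apply, Matrix.transpose_apply, matBI, sum_kronecker_one_mul,
    Matrix.of_apply, phsKernel_apply hk]
  simp only [mul_comm _ ((matB meth t ⊗ₖ (1 : Matrix (Fin n) (Fin n) ℝ)) r _)]
  rw [sum_kronecker_one_mul (matB meth t) r (fun y => ∑ i, matB meth t q.1 i *
    (σf ^ 2 * inner ℝ (fieldRep 𝓗 S (x (t i)) q.2) (fieldRep 𝓗 S (x (t y.1)) y.2)))]
  simp only [gridRep_eq, sum_inner, inner_sum, real_inner_smul_left, real_inner_smul_right,
    Finset.mul_sum]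
  exact Finset.sum_congr rfl fun i _ => Finset.sum_congr rfl fun j _ => by ring

lemma crossY_apply (hk : ContDiff ℝ 2 fun z : State n × State n => baseKernel 𝓗 z.1 z.2)
    (S : PortHamiltonian n m) (meth : VLMM M) (x : ℝ → State n) (σf : ℝ) (t : Fin K → ℝ)
    (z : State n) (q : Fin (K - M) × Fin n) (c : Fin n) :
    crossY (phsKernel S (baseKernel 𝓗) σf) meth x t z q c
      = σf ^ 2 * inner ℝ (gridRep 𝓗 S meth x t q) (fieldRep 𝓗 S z c) := by
  simp only [crossY, Matrix.mul_apply, matBI, sum_kronecker_one_mul, Matrix.of_apply,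
    phsKernel_apply hk, gridRep_eq, sum_inner, real_inner_smul_left, Finset.mul_sum]
  exact Finset.sum_congr rfl fun i _ => by ring

/-- The estimator is the field of a combination of the window representers solving the regularized
normal equations. -/
lemma exists_estimator_eq_field
    (hk : ContDiff ℝ 2 fun z : State n × State n => baseKernel 𝓗 z.1 z.2)
    (S : PortHamiltonian n m) (meth : VLMM M) (u : ℝ → Fin m → ℝ) (x : ℝ → State n) (σf : ℝ)
    (t : Fin K → ℝ) (ε : Fin K × Fin n → ℝ) {reg : ℝ} (hreg : 0 < ((K - M : ℕ) : ℝ) * reg) :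
    ∃ (g : 𝓗) (α : Fin (K - M) × Fin n → ℝ),
      estimator S (phsKernel S (baseKernel 𝓗) σf) meth u x reg t ε = S.field (g : State n → ℝ) ∧
      g = σf ^ 2 • ∑ q, α q • gridRep 𝓗 S meth x t q ∧
      ∀ q, inner ℝ (gridRep 𝓗 S meth x t q) g + ((K - M : ℕ) : ℝ) * reg * α q
        = labels S meth u x t ε q := by
  set φ := gridRep 𝓗 S meth x t with hφ
  set G := gramY (phsKernel S (baseKernel 𝓗) σf) meth x t with hG
  set L : ℝ := ((K - M : ℕ) : ℝ) * reg with hL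
  set y := labels S meth u x t ε with hy
  have hGapp : ∀ q r, G q r = σf ^ 2 * inner ℝ (φ q) (φ r) := gramY_apply hk S meth x σf t
  have hGpsd : G.PosSemidef := by
    refine Matrix.PosSemidef.of_dotProduct_mulVec_nonneg ?_ fun v => ?_
    · ext q r
      simp [Matrix.conjTranspose_apply, hGapp, real_inner_comm]
    · have : star v ⬝ᵥ (G *ᵥ v) = σf ^ 2 * inner ℝ (∑ q, v q • φ q) (∑ q, v q • φ q) := by
        simp only [dotProduct, Matrix.mulVec, hGapp, sum_inner, inner_sum, real_inner_smul_left,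
          real_inner_smul_right, Finset.mul_sum, Pi.star_apply, star_trivial]
        rw [Finset.sum_comm]
        exact Finset.sum_congr rfl fun i _ => Finset.sum_congr rfl fun j _ => by ring
      rw [this]
      exact mul_nonneg (sq_nonneg _) real_inner_self_nonneg
  -- Positive definiteness guarantees that `⁻¹` in the estimator is a genuine inverse rather than
  -- the default value.
  have hpd : (G + L • (1 : Matrix _ _ ℝ)).PosDef :=
    Matrix.PosDef.posSemidef_add hGpsd (Matrix.PosDef.one.smul hreg)
  set α := (G + L • (1 : Matrix _ _ ℝ))⁻¹ *ᵥ y with hα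
  have hsolve : (G + L • (1 : Matrix _ _ ℝ)) *ᵥ α = y := by
    rw [hα, Matrix.mulVec_mulVec, Matrix.mul_nonsing_inv _
      ((Matrix.isUnit_iff_isUnit_det _).1 hpd.isUnit), Matrix.one_mulVec]
  refine ⟨σf ^ 2 • ∑ q, α q • φ q, α, ?_, rfl, fun q => ?_⟩
  · funext z
    ext c
    rw [field_apply hk]
    change ((crossY (phsKernel S (baseKernel 𝓗) σf) meth x t z)ᵀ *ᵥ α) c = _
    simp only [Matrix.mulVec, dotProduct, Matrix.transpose_apply, crossY_apply hk,
      real_inner_smul_right, inner_sum, Finset.mul_sum]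
    exact Finset.sum_congr rfl fun q _ => by rw [real_inner_comm]; ring
  · have := congrFun hsolve q
    rw [Matrix.add_mulVec, Pi.add_apply, Matrix.smul_mulVec, Matrix.one_mulVec, Pi.smul_apply,
      smul_eq_mul] at this
    rw [← this]
    congr 1
    simp only [Matrix.mulVec, dotProduct, hGapp, real_inner_smul_right, inner_sum, Finset.mul_sum]
    exact Finset.sum_congr rfl fun r _ => by ring

/-- The labels are the multistep data of the true drift plus truncation error plus noise. -/
lemma labels_eq (hk : ContDiff ℝ 2 fun z : State n × State n => baseKernel 𝓗 z.1 z.2)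
    (S : PortHamiltonian n m) {g₀ : 𝓗} (hg₀ : (g₀ : State n → ℝ) = S.H) (meth : VLMM M)
    {u : ℝ → Fin m → ℝ} {x : ℝ → State n} (hx : S.IsTrajectory u x) {t : Fin K → ℝ}
    (ht : ∀ i, 0 ≤ t i) (ε : Fin K × Fin n → ℝ) (k : Fin (K - M)) (c : Fin n) :
    labels S meth u x t ε (k, c) = inner ℝ (gridRep 𝓗 S meth x t (k, c)) g₀
      + (∑ j, meth.a (nodeSteps fun j => t (winNode k j)) j • x (t (winNode k j))
        - ∑ j, meth.b (nodeSteps fun j => t (winNode k j)) j •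
          derivWithin x (Set.Ici 0) (t (winNode k j))) c
      + ∑ i, matA meth t k i * ε (i, c) := by
  have hder : ∀ s, 0 ≤ s → derivWithin x (Set.Ici 0) s
      = S.field (g₀ : State n → ℝ) (x s) + S.port (x s) (u s) := fun s hs => by
    rw [(hx s hs).derivWithin (uniqueDiffOn_Ici 0 s hs), hg₀]; rfl
  rw [← sum_matA_smul meth t k (fun i => x (t i)),
    ← sum_matB_smul meth t k (fun i => derivWithin x (Set.Ici 0) (t i)), inner_gridRep hk]
  simp only [hder _ (ht _), labels, Pi.sub_apply, Matrix.mulVec, dotProduct, matAI, matBI,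
    sum_kronecker_one_mul, PiLp.sub_apply, WithLp.ofLp_sum, Finset.sum_apply, PiLp.smul_apply,
    PiLp.add_apply, smul_eq_mul, mul_add, Finset.sum_add_distrib]
  ring

/-- The rows of `A` mix the errors, so the label noises of overlapping windows are dependent.
Regrouping by measurement gives a sum with independent coefficients `ε q`. -/
lemma sum_noise_smul_gridRep (S : PortHamiltonian n m) (meth : VLMM M) (x : ℝ → State n)
    (t : Fin K → ℝ) (ε : Fin K × Fin n → ℝ) :
    ∑ q : Fin (K - M) × Fin n, (∑ i, matA meth t q.1 i * ε (i, q.2)) • gridRep 𝓗 S meth x t q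
      = ∑ q, ε q • noiseRep 𝓗 S meth x t q := by
  simp only [noiseRep, Fintype.sum_prod_type, Finset.sum_smul, Finset.smul_sum, smul_smul]
  rw [Finset.sum_comm, Finset.sum_comm (γ := Fin K)]
  refine Finset.sum_congr rfl fun c _ => ?_
  rw [Finset.sum_comm]
  exact Finset.sum_congr rfl fun i _ => Finset.sum_congr rfl fun k _ => by rw [mul_comm]

end Estimator

/-- Error bound for a solution of regularized normal equations: `τ` is a deterministic error and
`ξ` a noise which enters only through the vector `∑ ξ_q φ_q`. -/
lemma regularized_error_bound {ι V : Type*} [Fintype ι] [NormedAddCommGroup V]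
    [InnerProductSpace ℝ V] (φ : ι → V) (α τ ξ : ι → ℝ) {g g₀ : V} {σ2 L : ℝ} (hσ2 : 0 < σ2)
    (hL : 0 < L) (hg : g = σ2 • ∑ q, α q • φ q)
    (heq : ∀ q, inner ℝ (φ q) g + L * α q = inner ℝ (φ q) g₀ + τ q + ξ q) :
    ∑ q, inner ℝ (φ q) (g - g₀) ^ 2 + L / σ2 * ‖g - g₀‖ ^ 2 ≤
      2 * (L / σ2) * ‖g₀‖ ^ 2 + 2 * ‖∑ q, ξ q • φ q‖ ^ 2 / (L / σ2) + ∑ q, τ q ^ 2 := by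
  set d := g - g₀ with hd
  set μ := L / σ2 with hμ
  have hμpos : 0 < μ := by positivity
  set Z := ∑ q, ξ q • φ q with hZ
  have h1 : ∀ q, inner ℝ (φ q) d ^ 2 + L * (α q * inner ℝ (φ q) d)
      = τ q * inner ℝ (φ q) d + ξ q * inner ℝ (φ q) d := by
    intro q
    have : inner ℝ (φ q) d = τ q + ξ q - L * α q := by
      rw [hd, inner_sub_right]; linarith [heq q]
    have e : inner ℝ (φ q) d ^ 2 = inner ℝ (φ q) d * (τ q + ξ q - L * α q) := by
      rw [sq]; congr 1
    rw [e]; ring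
  -- Energy identity: multiply the `q`-th normal equation by `⟪φ q, d⟫`, sum, and recognize `g` and
  -- the noise vector `Z`.
  have h2 : ∑ q, inner ℝ (φ q) d ^ 2 + μ * inner ℝ g d
      = ∑ q, τ q * inner ℝ (φ q) d + inner ℝ Z d := by
    have ha : μ * inner ℝ g d = ∑ q, L * (α q * inner ℝ (φ q) d) := by
      rw [hg, real_inner_smul_left, sum_inner, ← mul_assoc, hμ, div_mul_cancel₀ _ hσ2.ne',
        Finset.mul_sum]
      simp only [real_inner_smul_left]
    have hb : inner ℝ Z d = ∑ q, ξ q * inner ℝ (φ q) d := by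
      rw [hZ, sum_inner]; simp only [real_inner_smul_left]
    rw [ha, hb, ← Finset.sum_add_distrib, ← Finset.sum_add_distrib]
    exact Finset.sum_congr rfl fun q _ => h1 q
  have h3 : ∑ q, τ q * inner ℝ (φ q) d ≤ (∑ q, τ q ^ 2) / 2 + (∑ q, inner ℝ (φ q) d ^ 2) / 2 := by
    rw [Finset.sum_div, Finset.sum_div, ← Finset.sum_add_distrib]
    exact Finset.sum_le_sum fun q _ => by nlinarith [sq_nonneg (τ q - inner ℝ (φ q) d)]
  -- Here and in `h6` Young's inequality spends a quarter of `μ‖d‖²`, and `h3` half of the sum of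
  -- squares; the remaining halves, doubled, are the left side of the claim.
  have h4 : inner ℝ Z d ≤ ‖Z‖ ^ 2 / μ + μ * ‖d‖ ^ 2 / 4 := by
    refine (real_inner_le_norm _ _).trans ?_
    have : ‖Z‖ ^ 2 / μ + μ * ‖d‖ ^ 2 / 4 - ‖Z‖ * ‖d‖ = (‖Z‖ - μ * ‖d‖ / 2) ^ 2 / μ := by
      field_simp; ring
    have h0 : 0 ≤ (‖Z‖ - μ * ‖d‖ / 2) ^ 2 / μ := by positivity
    linarith
  have h5 : inner ℝ g d = ‖d‖ ^ 2 + inner ℝ g₀ d := by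
    rw [← real_inner_self_eq_norm_sq, ← inner_add_left, hd, sub_add_cancel]
  have h6 : -inner ℝ g₀ d ≤ ‖g₀‖ ^ 2 + ‖d‖ ^ 2 / 4 := by
    have := neg_abs_le (inner ℝ g₀ d)
    have := abs_real_inner_le_norm g₀ d
    nlinarith [sq_nonneg (‖g₀‖ - ‖d‖ / 2)]
  have h7 := mul_le_mul_of_nonneg_left h6 hμpos.le
  rw [h5] at h2
  have e : 2 * ‖Z‖ ^ 2 / μ = 2 * (‖Z‖ ^ 2 / μ) := by ring
  rw [e]
  nlinarith

/-! ### Bounds and measurability of the representers -/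

/-- Second countability of the domain gives strong measurability, so no separability of the RKHS or
of its tensor square has to be known. -/
lemma stronglyMeasurable_indicator_of_continuousOn {α β : Type*} [MeasurableSpace α]
    [TopologicalSpace α] [OpensMeasurableSpace α] [SecondCountableTopology α] [TopologicalSpace β]
    [TopologicalSpace.PseudoMetrizableSpace β] [Zero β] {f : α → β} {s : Set α}
    (hf : ContinuousOn f s) (hs : MeasurableSet s) : StronglyMeasurable (s.indicator f) := by
  refine stronglyMeasurable_of_stronglyMeasurable_union_cover s sᶜ hs hs.compl
    (Set.union_compl_self s).ge ?_ ?_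
  · have h : Continuous fun a : s => f a := continuousOn_iff_continuous_domRestrict.1 hf
    have e : (fun a : s => s.indicator f a) = fun a : s => f a :=
      funext fun a => Set.indicator_of_mem a.2 f
    rw [e]
    exact h.stronglyMeasurable
  · have e : (fun a : (sᶜ : Set α) => s.indicator f a) = fun _ => 0 :=
      funext fun a => Set.indicator_of_notMem a.2 f
    rw [e]
    exact stronglyMeasurable_const

section SquareTensor

open scoped TensorProduct

variable {V : Type*} [NormedAddCommGroup V] [InnerProductSpace ℝ V]

/-- The rank one element `v ⊗ v` of the Hilbert space tensor square. -/
def squareTensor (v : V) : UniformSpace.Completion (V ⊗[ℝ] V) := ((v ⊗ₜ[ℝ] v : V ⊗[ℝ] V) :)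

/-- This makes a quadratic form linear: a sum of `⟪φ, g⟫²` is the pairing of one random vector with
`squareTensor g`, and Cauchy–Schwarz then bounds its deviation uniformly over `g`. -/
lemma inner_squareTensor (v w : V) :
    inner ℝ (squareTensor v) (squareTensor w) = inner ℝ v w ^ 2 := by
  rw [squareTensor, squareTensor, UniformSpace.Completion.inner_coe, TensorProduct.inner_tmul, sq]

lemma norm_squareTensor (v : V) : ‖squareTensor v‖ = ‖v‖ ^ 2 := by
  rw [squareTensor, UniformSpace.Completion.norm_coe, TensorProduct.norm_tmul, sq]

lemma continuous_squareTensor : Continuous (squareTensor : V → _) :=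
  (UniformSpace.Completion.continuous_coe _).comp
    (TensorProduct.continuous_tmul.comp (continuous_id.prodMk continuous_id))

end SquareTensor

section Bounds

variable {n m K M : ℕ} {𝓗 : Type*} [NormedAddCommGroup 𝓗] [InnerProductSpace ℝ 𝓗]
  [CompleteSpace 𝓗] [RKHS ℝ 𝓗 (State n) ℝ] {S : PortHamiltonian n m} {meth : VLMM M}
  {x : ℝ → State n} {hmax ω : ℝ}

lemma continuousOn_windowRep
    (hk : ContDiff ℝ 2 fun z : State n × State n => baseKernel 𝓗 z.1 z.2)
    (hx : ContinuousOn x (Set.Ici 0)) (c : Fin n) :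
    ContinuousOn (windowRep 𝓗 S meth x c) (admissibleSet (M + 1) hmax ω) := by
  refine continuousOn_finsetSum _ fun j _ => (meth.continuousOn_b j).smul ?_
  refine (continuous_fieldRep hk S c).comp_continuousOn
    (hx.comp (continuous_apply j).continuousOn fun s hs => ?_)
  exact AdmissibleGrid.nonneg hs j

lemma norm_windowRep_le [NeZero M] {C κ : ℝ}
    (hC : ∀ s : Fin (M + 1) → ℝ, AdmissibleGrid hmax ω s → ∀ j,
      |meth.a (nodeSteps s) j| ≤ C ∧ |meth.b (nodeSteps s) j| ≤ C * nodeSteps s 0)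
    (hC0 : 0 < C) (hκ : ∀ t, 0 ≤ t → ∀ c, ‖fieldRep 𝓗 S (x t) c‖ ≤ κ)
    {s : Fin (M + 1) → ℝ} (hs : AdmissibleGrid hmax ω s) (c : Fin n) :
    ‖windowRep 𝓗 S meth x c s‖ ≤ (M + 1) * (C * |hmax| * κ) := by
  refine (norm_sum_le_of_le _ (n := fun _ => C * |hmax| * κ) fun j _ => ?_).trans (by simp)
  rw [norm_smul, Real.norm_eq_abs]
  refine mul_le_mul ((hC s hs j).2.trans ?_) (hκ _ (hs.nonneg j) c) (norm_nonneg _) (by positivity)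
  gcongr
  exact (hs.nodeSteps_le 0).trans (le_abs_self _)

lemma AdmissibleGrid.continuousOn_window (k : Fin (K - M)) :
    ContinuousOn (fun t : Fin K → ℝ => fun j : Fin (M + 1) => t (winNode k j))
      (admissibleSet K hmax ω) ∧
    Set.MapsTo (fun t : Fin K → ℝ => fun j : Fin (M + 1) => t (winNode k j))
      (admissibleSet K hmax ω) (admissibleSet (M + 1) hmax ω) :=
  ⟨(continuous_pi fun _ => continuous_apply _).continuousOn, fun _ ht =>
    AdmissibleGrid.window ht k⟩

lemma continuousOn_noiseRep
    (hk : ContDiff ℝ 2 fun z : State n × State n => baseKernel 𝓗 z.1 z.2)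
    (hx : ContinuousOn x (Set.Ici 0)) (q : Fin K × Fin n) :
    ContinuousOn (fun t => noiseRep 𝓗 S meth x t q) (admissibleSet K hmax ω) := by
  refine continuousOn_finsetSum _ fun k _ => ContinuousOn.smul ?_ ?_
  · simp only [matA, Matrix.of_apply]
    refine continuousOn_finsetSum _ fun j _ => ?_
    split_ifs
    · exact (meth.continuousOn_a j).comp (AdmissibleGrid.continuousOn_window k).1
        (AdmissibleGrid.continuousOn_window k).2
    · exact continuousOn_const
  · exact (continuousOn_windowRep hk hx q.2).comp (AdmissibleGrid.continuousOn_window k).1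
      (AdmissibleGrid.continuousOn_window k).2

/-- A grid node lies in at most `M + 1` windows, one for each position inside the window, so the
bound does not grow with `K`. -/
lemma norm_noiseRep_le [NeZero M] {C B : ℝ} (hB : 0 ≤ B)
    (hC : ∀ s : Fin (M + 1) → ℝ, AdmissibleGrid hmax ω s → ∀ j,
      |meth.a (nodeSteps s) j| ≤ C ∧ |meth.b (nodeSteps s) j| ≤ C * nodeSteps s 0)
    (hC0 : 0 < C) (hφ : ∀ s : Fin (M + 1) → ℝ, AdmissibleGrid hmax ω s → ∀ c,
      ‖windowRep 𝓗 S meth x c s‖ ≤ B) {t : Fin K → ℝ} (ht : AdmissibleGrid hmax ω t)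
    (q : Fin K × Fin n) : ‖noiseRep 𝓗 S meth x t q‖ ≤ (M + 1) * C * B := by
  have h1 : ∀ k : Fin (K - M), ‖matA meth t k q.1 • gridRep 𝓗 S meth x t (k, q.2)‖
      ≤ ∑ j : Fin (M + 1), if winNode k j = q.1 then C * B else 0 := by
    intro k
    rw [norm_smul, Real.norm_eq_abs]
    calc _ ≤ (∑ j : Fin (M + 1), if winNode k j = q.1 then C else 0) * B := by
          refine mul_le_mul ?_ (hφ _ (ht.window k) q.2) (norm_nonneg _)
            (Finset.sum_nonneg fun j _ => by split_ifs <;> positivity)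
          rw [matA, Matrix.of_apply]
          refine (Finset.abs_sum_le_sum_abs _ _).trans (Finset.sum_le_sum fun j _ => ?_)
          split_ifs
          · exact (hC _ (ht.window k) j).1
          · simp
      _ = _ := by
          rw [Finset.sum_mul]
          exact Finset.sum_congr rfl fun j _ => by split_ifs <;> simp
  refine (norm_sum_le_of_le _ fun k _ => h1 k).trans ?_
  rw [Finset.sum_comm]
  calc _ ≤ ∑ _j : Fin (M + 1), C * B := by
        refine Finset.sum_le_sum fun j _ => ?_
        rw [← Finset.sum_filter, Finset.sum_const, nsmul_eq_mul]
        refine mul_le_of_le_one_left (by positivity) ?_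
        exact_mod_cast Finset.card_le_one.2 fun k hk l hl => by
          have h := (Finset.mem_filter.1 hk).2.trans (Finset.mem_filter.1 hl).2.symm
          have := congrArg Fin.val h
          simp only [winNode] at this
          exact Fin.ext (by omega)
    _ = _ := by simp; ring

/-- The sum over components of the squares of the representers of an admissible window. -/
def windowCov (𝓗 : Type*) [NormedAddCommGroup 𝓗] [InnerProductSpace ℝ 𝓗] [CompleteSpace 𝓗]
    [RKHS ℝ 𝓗 (State n) ℝ] (S : PortHamiltonian n m) (meth : VLMM M) (x : ℝ → State n)
    (hmax ω : ℝ) : (Fin (M + 1) → ℝ) → UniformSpace.Completion (TensorProduct ℝ 𝓗 𝓗) :=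
  (admissibleSet (M + 1) hmax ω).indicator fun s => ∑ c, squareTensor (windowRep 𝓗 S meth x c s)

/-- The indicator in `windowCov` gives a function bounded and measurable everywhere, as the
concentration bound requires; almost surely it changes nothing. -/
lemma stronglyMeasurable_windowCov
    (hk : ContDiff ℝ 2 fun z : State n × State n => baseKernel 𝓗 z.1 z.2)
    (hx : ContinuousOn x (Set.Ici 0)) :
    StronglyMeasurable (windowCov 𝓗 S meth x hmax ω) :=
  stronglyMeasurable_indicator_of_continuousOn
    (continuousOn_finsetSum _ fun c _ =>
      continuous_squareTensor.comp_continuousOn (continuousOn_windowRep hk hx c))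
    (measurableSet_admissibleSet _ _ _)

lemma norm_windowCov_le {B : ℝ} (hφ : ∀ s : Fin (M + 1) → ℝ, AdmissibleGrid hmax ω s → ∀ c,
      ‖windowRep 𝓗 S meth x c s‖ ≤ B) (s : Fin (M + 1) → ℝ) :
    ‖windowCov 𝓗 S meth x hmax ω s‖ ≤ n * B ^ 2 := by
  by_cases hs : s ∈ admissibleSet (M + 1) hmax ω
  · rw [windowCov, Set.indicator_of_mem hs]
    refine (norm_sum_le_of_le _ (n := fun _ => B ^ 2) fun c _ => ?_).trans (by simp)
    rw [norm_squareTensor]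
    exact pow_le_pow_left₀ (norm_nonneg _) (hφ s hs c) 2
  · rw [windowCov, Set.indicator_of_notMem hs, norm_zero]
    positivity

lemma inner_windowCov {s : Fin (M + 1) → ℝ} (hs : AdmissibleGrid hmax ω s) (g : 𝓗) :
    inner ℝ (windowCov 𝓗 S meth x hmax ω s) (squareTensor g)
      = ∑ c, inner ℝ (windowRep 𝓗 S meth x c s) g ^ 2 := by
  rw [windowCov, Set.indicator_of_mem (show s ∈ admissibleSet (M + 1) hmax ω from hs), sum_inner]
  simp only [inner_squareTensor]

/-- A power of the first step of an admissible window. -/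
def windowStepPow (M : ℕ) [NeZero M] (hmax ω : ℝ) (r : ℕ) : (Fin (M + 1) → ℝ) → ℝ :=
  (admissibleSet (M + 1) hmax ω).indicator fun s => nodeSteps s 0 ^ r

lemma stronglyMeasurable_windowStepPow [NeZero M] (r : ℕ) :
    StronglyMeasurable (windowStepPow M hmax ω r) :=
  stronglyMeasurable_indicator_of_continuousOn
    (((continuous_apply 0).comp continuous_nodeSteps).pow r).continuousOn
    (measurableSet_admissibleSet _ _ _)

lemma norm_windowStepPow_le [NeZero M] (r : ℕ) (s : Fin (M + 1) → ℝ) :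
    ‖windowStepPow M hmax ω r s‖ ≤ |hmax| ^ r := by
  by_cases hs : s ∈ admissibleSet (M + 1) hmax ω
  · have h0 := AdmissibleGrid.nodeSteps_pos hs 0
    rw [windowStepPow, Set.indicator_of_mem hs, Real.norm_eq_abs, abs_of_pos (by positivity)]
    exact pow_le_pow_left₀ h0.le
      ((AdmissibleGrid.nodeSteps_le hs 0).trans (le_abs_self _)) r
  · rw [windowStepPow, Set.indicator_of_notMem hs, norm_zero]
    positivity

end Bounds

/-! ### The measurement noise -/

section Noise

variable {n K : ℕ} {Ω : Type*} [MeasurableSpace Ω] {P : Measure Ω}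
  {hmax ω : ℝ} {σx2 : ℝ≥0} {t : Fin K → Ω → ℝ} {ε : Fin K × Fin n → Ω → ℝ}

lemma IsSample.aemeasurable (h : IsSample P hmax ω σx2 t ε) (a : Fin K ⊕ (Fin K × Fin n)) :
    AEMeasurable (Sum.elim t ε a) P := by
  cases a with
  | inl i => exact (h.measurable_t i).aemeasurable
  | inr q => exact (h.gaussian q).aemeasurable

lemma IsSample.iIndepFun_times (h : IsSample P hmax ω σx2 t ε) : iIndepFun t P :=
  h.indep.precomp (g := Sum.inl) Sum.inl_injective

lemma IsSample.iIndepFun_noise (h : IsSample P hmax ω σx2 t ε) : iIndepFun ε P :=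
  h.indep.precomp (g := Sum.inr) Sum.inr_injective

lemma IsSample.indepFun_times_noise (h : IsSample P hmax ω σx2 t ε) :
    IndepFun (fun w i => t i w) (fun w q => ε q w) P := by
  classical
  let A : Finset (Fin K ⊕ (Fin K × Fin n)) := Finset.univ.map Function.Embedding.inl
  let B : Finset (Fin K ⊕ (Fin K × Fin n)) := Finset.univ.map Function.Embedding.inr
  have hAB : Disjoint A B := by
    rw [Finset.disjoint_left]
    intro a ha hb
    obtain ⟨i, -, rfl⟩ := Finset.mem_map.1 ha
    obtain ⟨q, -, hq⟩ := Finset.mem_map.1 hb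
    cases hq
  have hind := h.indep.indepFun_finset₀ A B hAB h.aemeasurable
  exact hind.comp
    (φ := fun y i => y ⟨Sum.inl i, Finset.mem_map.2 ⟨i, Finset.mem_univ _, rfl⟩⟩)
    (ψ := fun y q => y ⟨Sum.inr q, Finset.mem_map.2 ⟨q, Finset.mem_univ _, rfl⟩⟩)
    (measurable_pi_lambda _ fun i => measurable_pi_apply _)
    (measurable_pi_lambda _ fun q => measurable_pi_apply _)

/-- Exponential moments of the squared norm of a noise combination whose coefficients depend on the
sampling times. -/
lemma IsSample.lintegral_exp_noise_le [IsProbabilityMeasure P] {V : Type*}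
    [NormedAddCommGroup V] [InnerProductSpace ℝ V] (h : IsSample P hmax ω σx2 t ε) {U : Fin K × Fin n → (Fin K → ℝ) → V}
    (hU : ∀ q, StronglyMeasurable (U q)) {B : ℝ} (hUB : ∀ q y, ‖U q y‖ ≤ B) {v N : ℝ} (hv : 0 < v)
    (hBv : 2 * σx2 * B ^ 2 ≤ v) (hN : 1 ≤ N) (hKN : (K : ℝ) * n ≤ N) :
    ∫⁻ w, ENNReal.ofReal (Real.exp (‖∑ q, ε q w • U q (fun i => t i w)‖ ^ 2 / (2 * v * N))) ∂P ≤
      ENNReal.ofReal (Real.exp 1) := by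
  classical
  have hT : AEMeasurable (fun w i => t i w) P :=
    aemeasurable_pi_lambda _ fun i => (h.measurable_t i).aemeasurable
  have hE : AEMeasurable (fun w q => ε q w) P :=
    aemeasurable_pi_lambda _ fun q => (h.gaussian q).aemeasurable
  let G : (Fin K → ℝ) × (Fin K × Fin n → ℝ) → ℝ≥0∞ := fun p =>
    ENNReal.ofReal (Real.exp (‖∑ q, p.2 q • U q p.1‖ ^ 2 / (2 * v * N)))
  have hG : Measurable G := by
    have : StronglyMeasurable fun p : (Fin K → ℝ) × (Fin K × Fin n → ℝ) =>
        ∑ q, p.2 q • U q p.1 := by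
      refine Finset.stronglyMeasurable_fun_sum _ fun q _ => StronglyMeasurable.smul ?_ ?_
      · exact ((measurable_pi_apply q).comp measurable_snd).stronglyMeasurable
      · exact (hU q).comp_measurable measurable_fst
    have := this.norm.measurable
    fun_prop
  have : IsProbabilityMeasure (P.map fun w i => t i w) := Measure.isProbabilityMeasure_map hT
  have : IsProbabilityMeasure (P.map fun w q => ε q w) := Measure.isProbabilityMeasure_map hE
  -- For frozen times the sum has deterministic coefficients and independent Gaussian factors: each
  -- block is a single error.
  have hinner : ∀ y, ∫⁻ e, G (y, e) ∂(P.map fun w q => ε q w) ≤ ENNReal.ofReal (Real.exp 1) := by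
    intro y
    rw [lintegral_map' (by fun_prop) hE]
    let X : (q : Fin K × Fin n) → ((({q} : Finset (Fin K × Fin n)) → ℝ)) → V := fun q e =>
      e ⟨q, Finset.mem_singleton_self q⟩ • U q y
    refine lintegral_exp_norm_sum_sq_le (Y := ε) (fun q => (h.gaussian q).aemeasurable)
      h.iIndepFun_noise (fun q => {q}) (X := X) (fun q => ?_) hv hN Finset.univ ?_
      (fun q _ q' _ hq => by simpa using hq) (fun q _ => ?_)
    · exact (measurable_pi_apply _).stronglyMeasurable.smul_const _
    · simpa using hKN
    · refine hasSquareExpBound_gaussian_smul (h.gaussian q) hv (le_trans ?_ hBv)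
      have := pow_le_pow_left₀ (norm_nonneg _) (hUB q y) 2
      gcongr
  calc ∫⁻ w, G ((fun i => t i w), fun q => ε q w) ∂P
      = ∫⁻ p, G p ∂(P.map fun w => ((fun i => t i w), fun q => ε q w)) :=
        (lintegral_map' hG.aemeasurable (hT.prodMk hE)).symm
    _ = ∫⁻ y, ∫⁻ e, G (y, e) ∂(P.map fun w q => ε q w) ∂(P.map fun w i => t i w) := by
        rw [(indepFun_iff_map_prod_eq_prod_map_map hT hE).1 h.indepFun_times_noise,
          lintegral_prod _ hG.aemeasurable]
    _ ≤ ∫⁻ _, ENNReal.ofReal (Real.exp 1) ∂(P.map fun w i => t i w) := lintegral_mono hinner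
    _ = _ := by simp

end Noise

/-! ### Assembling the error bound -/

/-- In the application `A` and `W` are the empirical sum and the expected mean of squares, `D =
‖d‖²`, `Z` the squared noise norm, `T` the truncation sum, `μ` the mean step power, and `Δ`, `δ` the
deviations of covariance and step powers. The two bounds on `T` are used separately: the random one
for `A`, the deterministic one for `D`. -/
lemma error_rate_arithmetic {θ Λ ℓ ρ G₀ c₁ c₂ c₃ b CT hb μ A D Z T Δ δ W : ℝ} (hθ : 0 < θ)
    (hθ1 : θ ≤ 1) (hΛ : 1 ≤ Λ) (hℓ : ℓ * θ ^ 5 = 1) (hρ : 0 < ρ) (hG₀ : 0 ≤ G₀) (hc₁ : 0 ≤ c₁)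
    (hb0 : 0 ≤ b) (hCT : 0 ≤ CT) (hhb : 0 ≤ hb) (hA : 0 ≤ A) (hD : 0 ≤ D)
    (hc₂ : 0 ≤ c₂) (hc₃ : 0 ≤ c₃)
    (hmain : A + ℓ * (ρ * θ) * D ≤ 2 * (ℓ * (ρ * θ)) * G₀ + 2 * Z / (ℓ * (ρ * θ)) + T)
    (hZ : Z ≤ c₁ * Λ * ℓ) (hT : T ≤ CT * (ℓ * μ + δ)) (hδ : δ ^ 2 ≤ c₃ * Λ * ℓ)
    (hT' : T ≤ CT * (ℓ * hb)) (hΔ : Δ ^ 2 ≤ c₂ * Λ * ℓ) (hΔ' : Δ ≤ 2 * b * ℓ)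
    (hW : ℓ * W ≤ A + Δ * D) :
    W ≤ ((2 * ρ * G₀ + 2 * c₁ / ρ + CT * √c₃) + √c₂ * (2 * G₀) + 4 * b * c₁ / ρ ^ 2
        + CT * hb * √c₂ / ρ) * Λ * θ + CT * μ ∧
      D ≤ (2 * G₀ + 2 * c₁ / ρ ^ 2 + CT * hb / ρ) * Λ / θ := by
  have hℓe : ℓ = 1 / θ ^ 5 := by field_simp; exact hℓ
  have hℓpos : 0 < ℓ := by rw [hℓe]; positivity
  have hΛ0 : 0 < Λ := by linarith
  have hpow : ∀ i j : ℕ, i ≤ j → θ ^ j ≤ θ ^ i := fun i j h => pow_le_pow_of_le_one hθ.le hθ1 h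
  have hδ' : δ ≤ √c₃ * Λ / θ ^ 4 := by
    refine le_of_sq_le_sq (hδ.trans ?_) (by positivity)
    rw [div_pow, mul_pow, Real.sq_sqrt hc₃, hℓe, ← pow_mul, mul_one_div,
      div_le_div_iff₀ (by positivity) (by positivity)]
    have h1 := hpow 5 8 (by norm_num)
    have h2 : c₃ * Λ ≤ c₃ * Λ ^ 2 := by gcongr; nlinarith
    exact mul_le_mul h2 h1 (by positivity) (by positivity)
  have hΔ'' : Δ ≤ √c₂ * Λ / θ ^ 3 := by
    refine le_of_sq_le_sq (hΔ.trans ?_) (by positivity)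
    rw [div_pow, mul_pow, Real.sq_sqrt hc₂, hℓe, ← pow_mul, mul_one_div,
      div_le_div_iff₀ (by positivity) (by positivity)]
    have h1 := hpow 5 6 (by norm_num)
    have h2 : c₂ * Λ ≤ c₂ * Λ ^ 2 := by gcongr; nlinarith
    exact mul_le_mul h2 h1 (by positivity) (by positivity)
  have eμ : ℓ * (ρ * θ) = ρ / θ ^ 4 := by rw [hℓe]; field_simp
  rw [eμ] at hmain
  have hZ' : 2 * Z / (ρ / θ ^ 4) ≤ 2 * c₁ * Λ / (ρ * θ) := by
    calc 2 * Z / (ρ / θ ^ 4) ≤ 2 * (c₁ * Λ * ℓ) / (ρ / θ ^ 4) := by gcongr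
      _ = _ := by rw [hℓe]; field_simp
  have hAb : A * θ ^ 5 ≤ (2 * ρ * G₀ + 2 * c₁ / ρ + CT * √c₃) * Λ * θ + CT * μ := by
    have h1 : A ≤ 2 * (ρ / θ ^ 4) * G₀ + 2 * c₁ * Λ / (ρ * θ)
        + CT * (ℓ * μ + √c₃ * Λ / θ ^ 4) := by
      have : 0 ≤ ρ / θ ^ 4 * D := by positivity
      have : CT * (ℓ * μ + δ) ≤ CT * (ℓ * μ + √c₃ * Λ / θ ^ 4) := by gcongr
      linarith
    calc A * θ ^ 5 ≤ (2 * (ρ / θ ^ 4) * G₀ + 2 * c₁ * Λ / (ρ * θ)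
        + CT * (ℓ * μ + √c₃ * Λ / θ ^ 4)) * θ ^ 5 := by gcongr
      _ = 2 * ρ * G₀ * 1 * θ + 2 * c₁ / ρ * Λ * θ ^ 4 + CT * √c₃ * Λ * θ + CT * μ := by
        rw [hℓe]; field_simp; ring
      _ ≤ 2 * ρ * G₀ * Λ * θ + 2 * c₁ / ρ * Λ * θ ^ 1 + CT * √c₃ * Λ * θ + CT * μ := by
        have := hpow 1 4 (by norm_num)
        gcongr
      _ = _ := by ring
  have hDb : D ≤ 2 * G₀ + 2 * c₁ / ρ ^ 2 * Λ * θ ^ 3 + CT * hb / ρ / θ := by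
    have h1 : ρ / θ ^ 4 * D ≤ 2 * (ρ / θ ^ 4) * G₀ + 2 * c₁ * Λ / (ρ * θ) + CT * (ℓ * hb) := by
      linarith
    have h2 : D = θ ^ 4 / ρ * (ρ / θ ^ 4 * D) := by field_simp
    calc D = θ ^ 4 / ρ * (ρ / θ ^ 4 * D) := h2
      _ ≤ θ ^ 4 / ρ * (2 * (ρ / θ ^ 4) * G₀ + 2 * c₁ * Λ / (ρ * θ) + CT * (ℓ * hb)) := by gcongr
      _ = _ := by rw [hℓe]; field_simp
  constructor
  · have h1 : W = (ℓ * W) * θ ^ 5 := by linear_combination -W * hℓ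
    have h2 : Δ * D * θ ^ 5 ≤
        (√c₂ * (2 * G₀) + 4 * b * c₁ / ρ ^ 2 + CT * hb * √c₂ / ρ) * Λ * θ := by
      calc Δ * D * θ ^ 5 = D * (Δ * θ ^ 5) := by ring
        _ ≤ D * max 0 (Δ * θ ^ 5) := by gcongr; exact le_max_right _ _
        _ ≤ (2 * G₀ + 2 * c₁ / ρ ^ 2 * Λ * θ ^ 3 + CT * hb / ρ / θ) * max 0 (Δ * θ ^ 5) := by
          gcongr
        _ = 2 * G₀ * max 0 (Δ * θ ^ 5) + 2 * c₁ / ρ ^ 2 * Λ * θ ^ 3 * max 0 (Δ * θ ^ 5)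
            + CT * hb / ρ / θ * max 0 (Δ * θ ^ 5) := by ring
        -- The noise part of `D` already carries `Λ`; pairing it with the deterministic bound on `Δ`
        -- keeps the logarithm to the first power. The other two parts use the probabilistic bound.
        _ ≤ 2 * G₀ * (√c₂ * Λ * θ ^ 1) + 2 * c₁ / ρ ^ 2 * Λ * θ ^ 1 * (2 * b)
            + CT * hb / ρ / θ * (√c₂ * Λ * θ ^ 2) := by
          have m1 : max 0 (Δ * θ ^ 5) ≤ √c₂ * Λ * θ ^ 2 := by
            refine max_le (by positivity) ?_
            calc Δ * θ ^ 5 ≤ √c₂ * Λ / θ ^ 3 * θ ^ 5 := by gcongr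
              _ = _ := by field_simp
          have m2 : max 0 (Δ * θ ^ 5) ≤ 2 * b := by
            refine max_le (by positivity) ?_
            calc Δ * θ ^ 5 ≤ 2 * b * ℓ * θ ^ 5 := by gcongr
              _ = _ := by rw [mul_assoc, hℓ, mul_one]
          have m3 : max 0 (Δ * θ ^ 5) ≤ √c₂ * Λ * θ ^ 1 := m1.trans (by
            have := hpow 1 2 (by norm_num); gcongr)
          have p3 := hpow 1 3 (by norm_num)
          gcongr
        _ = _ := by field_simp; ring
    rw [h1]
    calc ℓ * W * θ ^ 5 ≤ (A + Δ * D) * θ ^ 5 := by gcongr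
      _ = A * θ ^ 5 + Δ * D * θ ^ 5 := by ring
      _ ≤ _ := by linarith
  · refine hDb.trans ?_
    rw [le_div_iff₀ hθ]
    have q1 : θ ≤ Λ := by linarith
    have q2 : θ ^ 4 ≤ 1 := pow_le_one₀ hθ.le hθ1
    calc (2 * G₀ + 2 * c₁ / ρ ^ 2 * Λ * θ ^ 3 + CT * hb / ρ / θ) * θ
        = 2 * G₀ * θ + 2 * c₁ / ρ ^ 2 * Λ * θ ^ 4 + CT * hb / ρ * 1 := by field_simp
      _ ≤ 2 * G₀ * Λ + 2 * c₁ / ρ ^ 2 * Λ * 1 + CT * hb / ρ * Λ := by gcongr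
      _ = _ := by ring

lemma log_three_mul_div_le {C η : ℝ} (hC : 1 ≤ C) (hη : 0 < η) (hη1 : η ≤ 1) :
    1 ≤ Real.log (4 / η) ∧ Real.log (C / (η / 3)) ≤ (1 + Real.log C) * Real.log (4 / η) := by
  have h4 : 1 ≤ Real.log (4 / η) := by
    rw [Real.le_log_iff_exp_le (by positivity), le_div_iff₀ hη]
    have := Real.exp_one_lt_d9
    nlinarith
  refine ⟨h4, ?_⟩
  have hC0 : 0 ≤ Real.log C := Real.log_nonneg hC
  calc Real.log (C / (η / 3)) ≤ Real.log (C * (4 / η)) := by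
        refine Real.log_le_log (by positivity) ?_
        rw [div_div_eq_mul_div, ← mul_div_assoc]
        gcongr
        norm_num
    _ = Real.log C + Real.log (4 / η) := Real.log_mul (by positivity) (by positivity)
    _ ≤ _ := by nlinarith

/-- Union bound for three exponential moment estimates. -/
lemma ofReal_one_sub_le_measure {Ω : Type*} [MeasurableSpace Ω] {P : Measure Ω}
    [IsProbabilityMeasure P] {Z₁ Z₂ Z₃ : Ω → ℝ} (h₁ : AEMeasurable Z₁ P) (h₂ : AEMeasurable Z₂ P)
    (h₃ : AEMeasurable Z₃ P) {C η : ℝ} (hC : 1 ≤ C) (hη : 0 < η) (hη1 : η ≤ 1)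
    (i₁ : ∫⁻ w, ENNReal.ofReal (Real.exp (Z₁ w)) ∂P ≤ ENNReal.ofReal C)
    (i₂ : ∫⁻ w, ENNReal.ofReal (Real.exp (Z₂ w)) ∂P ≤ ENNReal.ofReal C)
    (i₃ : ∫⁻ w, ENNReal.ofReal (Real.exp (Z₃ w)) ∂P ≤ ENNReal.ofReal C)
    {Q : Ω → Prop} (hQ : ∀ᵐ w ∂P, Q w) {R : Set Ω}
    (hR : ∀ w, Q w → Z₁ w ≤ (1 + Real.log C) * Real.log (4 / η) →
      Z₂ w ≤ (1 + Real.log C) * Real.log (4 / η) →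
      Z₃ w ≤ (1 + Real.log C) * Real.log (4 / η) → w ∈ R) :
    ENNReal.ofReal (1 - η) ≤ P R := by
  have hC0 : 0 < C := by linarith
  have hη3 : 0 < η / 3 := by positivity
  have hlog := (log_three_mul_div_le hC hη hη1).2
  have b₁ := measure_lt_le_of_lintegral_exp_le h₁ hC0 hη3 i₁
  have b₂ := measure_lt_le_of_lintegral_exp_le h₂ hC0 hη3 i₂
  have b₃ := measure_lt_le_of_lintegral_exp_le h₃ hC0 hη3 i₃
  have hsub : Rᶜ ⊆ (({w | Real.log (C / (η / 3)) < Z₁ w} ∪ {w | Real.log (C / (η / 3)) < Z₂ w}) ∪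
      {w | Real.log (C / (η / 3)) < Z₃ w}) ∪ {w | ¬ Q w} := by
    intro w hw
    by_contra hcon
    simp only [Set.mem_union, Set.mem_ofPred_eq, not_or, not_lt, not_not] at hcon
    exact hw (hR w hcon.2 (hcon.1.1.1.trans hlog) (hcon.1.1.2.trans hlog) (hcon.1.2.trans hlog))
  have hcompl : P Rᶜ ≤ ENNReal.ofReal η := by
    calc P Rᶜ ≤ _ := measure_mono hsub
      _ ≤ ((P {w | Real.log (C / (η / 3)) < Z₁ w} + P {w | Real.log (C / (η / 3)) < Z₂ w}) +
          P {w | Real.log (C / (η / 3)) < Z₃ w}) + P {w | ¬ Q w} :=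
        (measure_union_le _ _).trans (add_le_add_left ((measure_union_le _ _).trans
          (add_le_add_left (measure_union_le _ _) _)) _)
      _ ≤ ((ENNReal.ofReal (η / 3) + ENNReal.ofReal (η / 3)) + ENNReal.ofReal (η / 3)) + 0 := by
        gcongr
        exact (ae_iff.1 hQ).le
      _ = ENNReal.ofReal η := by
        rw [add_zero, ← ENNReal.ofReal_add hη3.le hη3.le,
          ← ENNReal.ofReal_add (by positivity) hη3.le]
        congr 1; ring
  -- Subadditivity replaces the complement formula because `R` need not be measurable.
  have huniv : (1 : ℝ≥0∞) ≤ P R + P Rᶜ := by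
    rw [← measure_univ (μ := P), ← Set.union_compl_self R]
    exact measure_union_le _ _
  rw [ENNReal.ofReal_sub _ hη.le, ENNReal.ofReal_one]
  exact tsub_le_iff_right.2 (huniv.trans (by gcongr))

section Observability

variable {n m K M : ℕ} {Ω : Type*} [MeasurableSpace Ω] {𝓗 : Type*} [NormedAddCommGroup 𝓗]
  [InnerProductSpace ℝ 𝓗] [RKHS ℝ 𝓗 (State n) ℝ]

/-- A positive observability constant is attained. -/
lemma obsConst_sq_mul_vNormSq_le {S : PortHamiltonian n m} {P : Measure Ω} {meth : VLMM M}
    {x : ℝ → State n} {t : Fin K → Ω → ℝ} {ν : Measure (State n)}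
    (h : 0 < obsConst 𝓗 S P meth x t ν) (g : 𝓗) :
    obsConst 𝓗 S P meth x t ν ^ 2 * vNormSq ν (S.field (g : State n → ℝ))
      ≤ wNormSq P meth x t (S.field (g : State n → ℝ)) := by
  set A : Set ℝ := {c : ℝ | 0 ≤ c ∧ ∀ g : 𝓗, c ^ 2 * vNormSq ν (S.field (g : State n → ℝ)) ≤
      wNormSq P meth x t (S.field (g : State n → ℝ))} with hA
  have hdef : obsConst 𝓗 S P meth x t ν = sSup A := rfl
  rw [hdef] at h ⊢
  -- `sSup` of an unbounded set has the default value 0, excluded by `h`; closedness of `A` then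
  -- gives attainment.
  have hbdd : BddAbove A := by
    by_contra hn
    rw [Real.sSup_of_not_bddAbove hn] at h
    exact lt_irrefl _ h
  have hne : A.Nonempty := by
    by_contra hn
    rw [Set.not_nonempty_iff_eq_empty.1 hn, Real.sSup_empty] at h
    exact lt_irrefl _ h
  have hclosed : IsClosed A := by
    rw [hA, Set.ofPred_and]
    refine IsClosed.inter isClosed_Ici ?_
    rw [Set.ofPred_forall]
    exact isClosed_iInter fun g => isClosed_le (by fun_prop) continuous_const
  exact (hclosed.csSup_mem hne hbdd).2 g

end Observability

/-! ### Sampling norm and mean step power as means of window functions -/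

section Norms

variable {n m K M : ℕ} {Ω : Type*} [MeasurableSpace Ω] {P : Measure Ω}
  {𝓗 : Type*} [NormedAddCommGroup 𝓗] [InnerProductSpace ℝ 𝓗] [CompleteSpace 𝓗]
  [RKHS ℝ 𝓗 (State n) ℝ] {S : PortHamiltonian n m} {meth : VLMM M} {x : ℝ → State n}
  {hmax ω : ℝ} {t : Fin K → Ω → ℝ}

/-- Pulling the integral through the pairing identifies the sampling norm with the mean covariance;
`sum_inner_gridRep_sq` is the empirical counterpart. -/
lemma mul_wNormSq_eq [IsProbabilityMeasure P]
    (hk : ContDiff ℝ 2 fun z : State n × State n => baseKernel 𝓗 z.1 z.2)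
    (hx : ContinuousOn x (Set.Ici 0)) {b : ℝ}
    (hb : ∀ s, ‖windowCov 𝓗 S meth x hmax ω s‖ ≤ b) (hKM : M < K) (htm : ∀ i, Measurable (t i))
    (hadm : ∀ᵐ w ∂P, AdmissibleGrid hmax ω (fun i => t i w)) (g : 𝓗) :
    ((K - M : ℕ) : ℝ) * wNormSq P meth x t (S.field (g : State n → ℝ))
      = inner ℝ (∑ k : Fin (K - M),
          ∫ w, windowCov 𝓗 S meth x hmax ω (fun j => t (winNode k j) w) ∂P) (squareTensor g) := by
  have hℓ : ((K - M : ℕ) : ℝ) ≠ 0 := by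
    have : K - M ≠ 0 := by omega
    exact_mod_cast this
  rw [wNormSq, mul_div_cancel₀ _ hℓ, sum_inner]
  refine Finset.sum_congr rfl fun k _ => ?_
  have hXint : Integrable (fun w => windowCov 𝓗 S meth x hmax ω (fun j => t (winNode k j) w)) P :=
    Integrable.of_bound ((stronglyMeasurable_windowCov hk hx).comp_measurable
      (measurable_pi_lambda _ fun j => htm _)).aestronglyMeasurable b
      (Filter.Eventually.of_forall fun w => hb _)
  rw [real_inner_comm, ← integral_inner hXint]
  refine integral_congr_ae ?_
  filter_upwards [hadm] with w hw
  rw [norm_sum_matB_field_sq hk, real_inner_comm, inner_windowCov (hw.window k)]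
  rfl

lemma sum_inner_gridRep_sq {τ : Fin K → ℝ} (hτ : AdmissibleGrid hmax ω τ) (g : 𝓗) :
    ∑ q : Fin (K - M) × Fin n, inner ℝ (gridRep 𝓗 S meth x τ q) g ^ 2
      = inner ℝ (∑ k : Fin (K - M), windowCov 𝓗 S meth x hmax ω (fun j => τ (winNode k j)))
          (squareTensor g) := by
  rw [sum_inner, Fintype.sum_prod_type]
  exact Finset.sum_congr rfl fun k _ => by rw [inner_windowCov (hτ.window k)]; rfl

lemma mul_meanStepPow_eq [NeZero M] (hKM : M < K)
    (hadm : ∀ᵐ w ∂P, AdmissibleGrid hmax ω (fun i => t i w)) (r : ℕ) :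
    ((K - M : ℕ) : ℝ) * meanStepPow (M := M) P t r
      = ∑ k : Fin (K - M), ∫ w, windowStepPow M hmax ω r (fun j => t (winNode k j) w) ∂P := by
  have hℓ : ((K - M : ℕ) : ℝ) ≠ 0 := by
    have : K - M ≠ 0 := by omega
    exact_mod_cast this
  rw [meanStepPow, mul_div_cancel₀ _ hℓ]
  refine Finset.sum_congr rfl fun k _ => integral_congr_ae ?_
  filter_upwards [hadm] with w hw
  have : (fun j => t (winNode k j) w) ∈ admissibleSet (M + 1) hmax ω := hw.window k
  rw [windowStepPow, Set.indicator_of_mem this]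
  rfl

end Norms

set_option maxHeartbeats 1000000 in
/-- With high probability the estimator is the field of an element of the RKHS whose distance to the
true energy is controlled, both in the sampling norm and in the RKHS norm. -/
theorem exists_estimator_error_bound {n m M p : ℕ} [NeZero M]
    (𝓗 : Type*) [NormedAddCommGroup 𝓗] [InnerProductSpace ℝ 𝓗] [CompleteSpace 𝓗]
    [RKHS ℝ 𝓗 (State n) ℝ]
    (hk : ContDiff ℝ 2 (fun z : State n × State n => baseKernel 𝓗 z.1 z.2))
    (S : PortHamiltonian n m) {g₀ : 𝓗} (hg₀ : (g₀ : State n → ℝ) = S.H)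
    (u : ℝ → Fin m → ℝ) (x : ℝ → State n) (hx : S.IsTrajectory u x)
    (hxsmooth : ContDiffOn ℝ ((p + 1 : ℕ) : WithTop ℕ∞) x (Set.Ici 0))
    (hxbound : ∃ D : ℝ, ∀ t, 0 ≤ t → ‖iteratedDerivWithin (p + 1) x (Set.Ici 0) t‖ ≤ D)
    (σf : ℝ) (hσf : 0 < σf)
    (hκ : ∃ κ : ℝ, ∀ t, 0 ≤ t →
      (phsKernel S (baseKernel 𝓗) σf (x t) (x t)).trace ≤ κ ^ 2)
    (meth : VLMM M) (hp : meth.HasOrder p)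
    (hmax ω : ℝ) (σx2 : ℝ≥0) (reg₀ : ℝ) (hreg₀ : 0 < reg₀) :
    ∃ Cfit : ℝ, 0 < Cfit ∧ ∃ Cbias : ℝ, 0 < Cbias ∧ ∃ Cnorm : ℝ, 0 < Cnorm ∧
      ∀ (K : ℕ), M < K →
      ∀ {Ω : Type*} [MeasurableSpace Ω] (P : Measure Ω) [IsProbabilityMeasure P]
        (t : Fin K → Ω → ℝ) (ε : Fin K × Fin n → Ω → ℝ), IsSample P hmax ω σx2 t ε →
      -- Stated for any set `R` forced by the two bounds, so that one estimate serves both cases of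
      -- the observability constant.
      ∀ η : ℝ, 0 < η → η ≤ 1 → ∀ R : Set Ω,
        (∀ w, ∀ d : 𝓗,
          estimator S (phsKernel S (baseKernel 𝓗) σf) meth u x
            (reg₀ * ((K - M : ℕ) : ℝ) ^ (-(1 / 5 : ℝ))) (fun i => t i w) (fun q => ε q w) - S.drift
            = S.field (d : State n → ℝ) →
          wNormSq P meth x t (S.field (d : State n → ℝ)) ≤
            Cfit * Real.log (4 / η) * ((K - M : ℕ) : ℝ) ^ (-(1 / 5 : ℝ))
              + Cbias * meanStepPow (M := M) P t (2 * p + 2) →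
          ‖d‖ ^ 2 ≤ Cnorm * Real.log (4 / η) / ((K - M : ℕ) : ℝ) ^ (-(1 / 5 : ℝ)) → w ∈ R) →
        ENNReal.ofReal (1 - η) ≤ P R := by
  obtain ⟨D, hD⟩ := hxbound
  obtain ⟨κ, hκ⟩ := hκ
  obtain ⟨C, hC0, hC⟩ := meth.exists_coeff_bound hmax ω
  obtain ⟨Cτ, hCτ0, hCτ⟩ := VLMM.exists_truncation_bound hp hmax ω hxsmooth hD
  have hxc : ContinuousOn x (Set.Ici 0) := hxsmooth.continuousOn
  have hrep : ∀ t, 0 ≤ t → ∀ c, ‖fieldRep 𝓗 S (x t) c‖ ≤ |κ| / σf := by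
    intro t ht c
    have h1 := hκ t ht
    rw [trace_phsKernel hk] at h1
    have h2 : ‖fieldRep 𝓗 S (x t) c‖ ^ 2 ≤ ∑ c, ‖fieldRep 𝓗 S (x t) c‖ ^ 2 :=
      Finset.single_le_sum (f := fun c => ‖fieldRep 𝓗 S (x t) c‖ ^ 2)
        (fun _ _ => sq_nonneg _) (Finset.mem_univ c)
    refine le_of_sq_le_sq ?_ (by positivity)
    rw [div_pow, sq_abs, le_div_iff₀ (by positivity)]
    rw [mul_comm]
    exact (mul_le_mul_of_nonneg_left h2 (sq_nonneg σf)).trans h1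
  set B : ℝ := (M + 1) * (C * |hmax| * (|κ| / σf)) with hBdef
  have hB0 : 0 ≤ B := by positivity
  have hφ : ∀ s : Fin (M + 1) → ℝ, AdmissibleGrid hmax ω s → ∀ c,
      ‖windowRep 𝓗 S meth x c s‖ ≤ B := fun s hs c => norm_windowRep_le hC hC0 hrep hs c
  set B' : ℝ := (M + 1) * C * B with hB'def
  have hB'0 : 0 ≤ B' := by positivity
  -- The summands 1 here, in `hb` and in `v` keep these constants positive in degenerate cases such
  -- as `n = 0`.
  set b : ℝ := n * B ^ 2 + 1 with hbdef
  have hb0 : 0 < b := by positivity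
  have hcov : ∀ s, ‖windowCov 𝓗 S meth x hmax ω s‖ ≤ b := fun s =>
    (norm_windowCov_le hφ s).trans (by linarith)
  set hb : ℝ := |hmax| ^ (2 * p + 2) + 1 with hhbdef
  have hhb0 : 0 < hb := by positivity
  have hstep : ∀ s, ‖windowStepPow M hmax ω (2 * p + 2) s‖ ≤ hb := fun s =>
    (norm_windowStepPow_le _ s).trans (by linarith)
  set v : ℝ := 2 * σx2 * B' ^ 2 + 1 with hvdef
  have hv0 : 0 < v := by positivity
  set E : ℝ := (M + 1) * Real.exp 1 with hEdef
  have hE1' : Real.exp 1 ≤ E := le_mul_of_one_le_left (Real.exp_pos _).le (by simp)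
  have hE1 : 1 ≤ E := le_trans (by linarith [Real.add_one_le_exp 1]) hE1'
  set a : ℝ := 1 + Real.log E with hadef
  have ha0 : 0 < a := by linarith [Real.log_nonneg hE1]
  set c₁ : ℝ := a * (2 * v * ((M + 1) * (n + 1))) with hc₁
  set c₂ : ℝ := a * (16 * b ^ 2 * (M + 1) ^ 2) with hc₂
  set c₃ : ℝ := a * (16 * hb ^ 2 * (M + 1) ^ 2) with hc₃
  have hc₁0 : 0 < c₁ := by positivity
  have hc₂0 : 0 < c₂ := by positivity
  have hc₃0 : 0 < c₃ := by positivity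
  set ρ : ℝ := reg₀ / σf ^ 2 with hρdef
  have hρ0 : 0 < ρ := by positivity
  set G₀ : ℝ := ‖g₀‖ ^ 2 with hG₀def
  have hG₀ : 0 ≤ G₀ := by positivity
  refine ⟨((2 * ρ * G₀ + 2 * c₁ / ρ + Cτ ^ 2 * √c₃) + √c₂ * (2 * G₀) + 4 * b * c₁ / ρ ^ 2
        + Cτ ^ 2 * hb * √c₂ / ρ), by positivity, Cτ ^ 2, by positivity,
        2 * G₀ + 2 * c₁ / ρ ^ 2 + Cτ ^ 2 * hb / ρ, by positivity, ?_⟩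
  intro K hKM Ω _ P _ t ε hsample η hη hη1 R hR
  set ℓ : ℝ := ((K - M : ℕ) : ℝ) with hℓdef
  have hℓ1 : 1 ≤ ℓ := by
    have : 1 ≤ K - M := by omega
    rw [hℓdef]; exact_mod_cast this
  have hℓ0 : 0 < ℓ := by linarith
  set θ : ℝ := ℓ ^ (-(1 / 5 : ℝ)) with hθdef
  have hθ0 : 0 < θ := Real.rpow_pos_of_pos hℓ0 _
  have hθ1 : θ ≤ 1 := Real.rpow_le_one_of_one_le_of_nonpos hℓ1 (by norm_num)
  have hℓθ : ℓ * θ ^ 5 = 1 := by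
    rw [hθdef, ← Real.rpow_natCast, ← Real.rpow_mul hℓ0.le]
    norm_num
    rw [Real.rpow_neg_one, mul_inv_cancel₀ hℓ0.ne']
  set U : Fin K × Fin n → (Fin K → ℝ) → 𝓗 := fun q =>
    (admissibleSet K hmax ω).indicator fun τ => noiseRep 𝓗 S meth x τ q with hU
  have hUm : ∀ q, StronglyMeasurable (U q) := fun q =>
    stronglyMeasurable_indicator_of_continuousOn (continuousOn_noiseRep hk hxc q)
      (measurableSet_admissibleSet _ _ _)
  have hUB : ∀ q y, ‖U q y‖ ≤ B' := by
    intro q y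
    by_cases hy : y ∈ admissibleSet K hmax ω
    · rw [hU]
      simp only [Set.indicator_of_mem hy]
      exact norm_noiseRep_le hB0 hC hC0 hφ hy q
    · rw [hU]
      simpa only [Set.indicator_of_notMem hy, norm_zero] using hB'0
  -- `N` dominates the number `K * n` of error coordinates, since `K = ℓ + M ≤ (M + 1)ℓ`, and is at
  -- least 1.
  set N : ℝ := (M + 1) * (n + 1) * ℓ with hNdef
  have hN1 : 1 ≤ N :=
    one_le_mul_of_one_le_of_one_le (one_le_mul_of_one_le_of_one_le (by simp) (by simp)) hℓ1
  have hKN : (K : ℝ) * n ≤ N := by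
    have h1 : (K : ℝ) = ℓ + M := by
      rw [hℓdef, Nat.cast_sub hKM.le]; ring
    have h2 : (K : ℝ) ≤ (M + 1) * ℓ := by
      rw [h1, add_mul, one_mul, add_comm]
      gcongr
      exact le_mul_of_one_le_right (Nat.cast_nonneg _) hℓ1
    calc (K : ℝ) * n ≤ (M + 1) * ℓ * (n + 1) := by gcongr; linarith
      _ = N := by rw [hNdef]; ring
  -- The noise bound `e` is relaxed to `E = (M + 1)e` so that all three estimates share one
  -- constant.
  have I₁ := (hsample.lintegral_exp_noise_le hUm hUB hv0 (by linarith) hN1 hKN).trans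
    (ENNReal.ofReal_le_ofReal hE1')
  have I₂ := lintegral_exp_norm_window_sum_sq_le (P := P) hKM hsample.measurable_t
    hsample.iIndepFun_times (stronglyMeasurable_windowCov (S := S) (meth := meth) (hmax := hmax)
      (ω := ω) hk hxc) hb0 hcov
  have I₃ := lintegral_exp_norm_window_sum_sq_le (P := P) hKM hsample.measurable_t
    hsample.iIndepFun_times (stronglyMeasurable_windowStepPow (M := M) (hmax := hmax) (ω := ω)
      (2 * p + 2)) hhb0 hstep
  have hwm : ∀ k : Fin (K - M), Measurable fun w => fun j => t (winNode k j) w := fun k =>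
    measurable_pi_lambda _ fun j => hsample.measurable_t _
  refine ofReal_one_sub_le_measure ?_ ?_ ?_ hE1 hη hη1 I₁ I₂ I₃ hsample.admissible ?_
  · have h1 : AEStronglyMeasurable (fun w => ∑ q, ε q w • U q (fun i => t i w)) P :=
      Finset.aestronglyMeasurable_fun_sum _ fun q _ =>
        (hsample.gaussian q).aemeasurable.aestronglyMeasurable.smul
          ((hUm q).comp_measurable
            (measurable_pi_lambda _ fun i => hsample.measurable_t i)).aestronglyMeasurable
    exact (h1.norm.aemeasurable.pow_const 2).div_const _
  · have h1 : StronglyMeasurable fun w => ∑ k : Fin (K - M),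
        (windowCov 𝓗 S meth x hmax ω (fun j => t (winNode k j) w)
          - ∫ w', windowCov 𝓗 S meth x hmax ω (fun j => t (winNode k j) w') ∂P) :=
      Finset.stronglyMeasurable_fun_sum _ fun k _ =>
        ((stronglyMeasurable_windowCov hk hxc).comp_measurable (hwm k)).sub stronglyMeasurable_const
    exact (h1.norm.measurable.aemeasurable.pow_const 2).div_const _
  · have h1 : StronglyMeasurable fun w => ∑ k : Fin (K - M),
        (windowStepPow M hmax ω (2 * p + 2) (fun j => t (winNode k j) w)
          - ∫ w', windowStepPow M hmax ω (2 * p + 2) (fun j => t (winNode k j) w') ∂P) :=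
      Finset.stronglyMeasurable_fun_sum _ fun k _ =>
        ((stronglyMeasurable_windowStepPow _).comp_measurable (hwm k)).sub stronglyMeasurable_const
    exact (h1.norm.measurable.aemeasurable.pow_const 2).div_const _
  intro w hw z₁ z₂ z₃
  set Λ : ℝ := Real.log (4 / η) with hΛdef
  have hΛ1 : 1 ≤ Λ := (log_three_mul_div_le hE1 hη hη1).1
  set τ : Fin K → ℝ := fun i => t i w with hτdef
  set e : Fin K × Fin n → ℝ := fun q => ε q w with hedef
  have hreg : 0 < ((K - M : ℕ) : ℝ) * (reg₀ * θ) := by positivity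
  obtain ⟨g, α, hest, hg, heq⟩ := exists_estimator_eq_field (𝓗 := 𝓗) hk S meth u x σf τ e hreg
  set trunc : Fin (K - M) → State n := fun k =>
    ∑ j, meth.a (nodeSteps fun j => τ (winNode k j)) j • x (τ (winNode k j))
      - ∑ j, meth.b (nodeSteps fun j => τ (winNode k j)) j •
          derivWithin x (Set.Ici 0) (τ (winNode k j)) with htrunc
  have hridge := regularized_error_bound (gridRep 𝓗 S meth x τ) α (fun q => trunc q.1 q.2)
    (fun q => ∑ i, matA meth τ q.1 i * e (i, q.2)) (g := g) (g₀ := g₀)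
    (show 0 < σf ^ 2 by positivity) hreg hg
    (fun q => by rw [heq q]; exact labels_eq hk S hg₀ meth hx hw.nonneg e q.1 q.2)
  rw [sum_noise_smul_gridRep] at hridge
  have hUw : ∀ q, U q τ = noiseRep 𝓗 S meth x τ q := fun q =>
    Set.indicator_of_mem (show τ ∈ admissibleSet K hmax ω from hw) _
  have hdiff : estimator S (phsKernel S (baseKernel 𝓗) σf) meth u x (reg₀ * θ) τ e - S.drift
      = S.field (⇑(g - g₀) : State n → ℝ) := by
    rw [hest, field_sub hk, PortHamiltonian.drift, hg₀]
  set Z : ℝ := ‖∑ q, e q • noiseRep 𝓗 S meth x τ q‖ ^ 2 with hZdef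
  set cov : Fin (K - M) → UniformSpace.Completion (TensorProduct ℝ 𝓗 𝓗) := fun k =>
    windowCov 𝓗 S meth x hmax ω (fun j => τ (winNode k j)) with hcovdef
  set mcov : Fin (K - M) → UniformSpace.Completion (TensorProduct ℝ 𝓗 𝓗) := fun k =>
    ∫ w', windowCov 𝓗 S meth x hmax ω (fun j => t (winNode k j) w') ∂P with hmcovdef
  set Δ : ℝ := ‖∑ k, (cov k - mcov k)‖ with hΔdef
  set δ : ℝ := ∑ k : Fin (K - M), (windowStepPow M hmax ω (2 * p + 2) (fun j => τ (winNode k j))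
          - ∫ w', windowStepPow M hmax ω (2 * p + 2) (fun j => t (winNode k j) w') ∂P) with hδdef
  have hZ : Z ≤ c₁ * Λ * ℓ := by
    have h1 : Z / (2 * v * N) ≤ a * Λ := by simpa only [hUw] using z₁
    rw [div_le_iff₀ (by positivity)] at h1
    refine h1.trans_eq ?_
    rw [hc₁, hNdef]; ring
  have hΔ : Δ ^ 2 ≤ c₂ * Λ * ℓ := by
    have h1 : Δ ^ 2 / (16 * b ^ 2 * (M + 1) ^ 2 * ℓ) ≤ a * Λ := z₂
    rw [div_le_iff₀ (by positivity)] at h1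
    refine h1.trans_eq ?_
    rw [hc₂]; ring
  have hδ : δ ^ 2 ≤ c₃ * Λ * ℓ := by
    have h1 : ‖δ‖ ^ 2 / (16 * hb ^ 2 * (M + 1) ^ 2 * ℓ) ≤ a * Λ := z₃
    rw [div_le_iff₀ (by positivity), Real.norm_eq_abs, sq_abs] at h1
    refine h1.trans_eq ?_
    rw [hc₃]; ring
  have hΔ' : Δ ≤ 2 * b * ℓ := by
    refine (norm_sum_le_of_le _ (n := fun _ => 2 * b) fun k _ => ?_).trans_eq ?_
    · have h1 : ‖mcov k‖ ≤ b := by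
        simpa using norm_integral_le_of_norm_le_const (μ := P)
          (Filter.Eventually.of_forall fun w' => hcov (fun j => t (winNode k j) w'))
      exact (norm_sub_le _ _).trans (by linarith [hcov (fun j => τ (winNode k j))])
    · simp [hℓdef]; ring
  have hTk : ∀ k, ∑ c, trunc k c ^ 2
      ≤ Cτ ^ 2 * windowStepPow M hmax ω (2 * p + 2) (fun j => τ (winNode k j)) := by
    intro k
    have h1 := hCτ _ (hw.window k)
    have h2 : ∑ c, trunc k c ^ 2 = ‖trunc k‖ ^ 2 := by
      rw [EuclideanSpace.norm_sq_eq]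
      simp only [Real.norm_eq_abs, sq_abs]
    have hmem : (fun j => τ (winNode k j)) ∈ admissibleSet (M + 1) hmax ω := hw.window k
    rw [h2, windowStepPow, Set.indicator_of_mem hmem]
    refine (pow_le_pow_left₀ (norm_nonneg _) h1 2).trans_eq ?_
    rw [mul_pow, ← pow_mul]
    congr 2
    ring
  have hTsum : ∑ q : Fin (K - M) × Fin n, trunc q.1 q.2 ^ 2
      ≤ Cτ ^ 2 * ∑ k : Fin (K - M),
          windowStepPow M hmax ω (2 * p + 2) (fun j => τ (winNode k j)) := by
    rw [Fintype.sum_prod_type, Finset.mul_sum]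
    exact Finset.sum_le_sum fun k _ => hTk k
  have hT : ∑ q : Fin (K - M) × Fin n, trunc q.1 q.2 ^ 2
      ≤ Cτ ^ 2 * (ℓ * meanStepPow (M := M) P t (2 * p + 2) + δ) := by
    refine hTsum.trans_eq ?_
    rw [hℓdef, mul_meanStepPow_eq hKM hsample.admissible, hδdef, Finset.sum_sub_distrib]
    ring
  have hT' : ∑ q : Fin (K - M) × Fin n, trunc q.1 q.2 ^ 2 ≤ Cτ ^ 2 * (ℓ * hb) := by
    refine hTsum.trans ?_
    gcongr
    calc _ ≤ ∑ _k : Fin (K - M), hb :=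
          Finset.sum_le_sum fun k _ => (le_abs_self _).trans (hstep _)
      _ = _ := by simp [hℓdef]
  -- The element `g - g₀` is random, whereas `wNormSq` takes the expectation with the field held
  -- fixed. The bound `Δ‖squareTensor‖ = Δ‖g - g₀‖²` is legitimate because it holds for all elements
  -- at once.
  have hW : ℓ * wNormSq P meth x t (S.field (⇑(g - g₀) : State n → ℝ))
      ≤ ∑ q, inner ℝ (gridRep 𝓗 S meth x τ q) (g - g₀) ^ 2 + Δ * ‖g - g₀‖ ^ 2 := by
    rw [hℓdef, mul_wNormSq_eq hk hxc hcov hKM hsample.measurable_t hsample.admissible,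
      sum_inner_gridRep_sq hw]
    have h1 := abs_real_inner_le_norm (∑ k, (cov k - mcov k)) (squareTensor (g - g₀))
    rw [norm_squareTensor, Finset.sum_sub_distrib, inner_sub_left, ← Finset.sum_sub_distrib] at h1
    have h2 := neg_abs_le (inner ℝ (∑ k, cov k) (squareTensor (g - g₀))
      - inner ℝ (∑ k, mcov k) (squareTensor (g - g₀)))
    linarith
  have eL : ((K - M : ℕ) : ℝ) * (reg₀ * θ) / σf ^ 2 = ℓ * (ρ * θ) := by
    rw [hρdef, hℓdef]; ring
  rw [eL] at hridge
  obtain ⟨r₁, r₂⟩ := error_rate_arithmetic hθ0 hθ1 hΛ1 hℓθ hρ0 hG₀ hc₁0.le hb0.le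
    (sq_nonneg Cτ) hhb0.le (Finset.sum_nonneg fun q _ => sq_nonneg _) (sq_nonneg ‖g - g₀‖)
    hc₂0.le hc₃0.le hridge hZ hT hδ hT' hΔ hΔ' hW
  exact hR w (g - g₀) hdiff r₁ r₂

end MSPHS

end

/-! ### From the sampling norm to the norm of `L²(ν)` -/

theorem proposition1 {n m M p : ℕ} [NeZero M]
    (𝓗 : Type*) [NormedAddCommGroup 𝓗] [InnerProductSpace ℝ 𝓗] [CompleteSpace 𝓗]
    [RKHS ℝ 𝓗 (MSPHS.State n) ℝ]
    (hk : ContDiff ℝ 2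
      (fun z : MSPHS.State n × MSPHS.State n => MSPHS.baseKernel 𝓗 z.1 z.2))
    (S : MSPHS.PortHamiltonian n m)
    (hH : ∃ g : 𝓗, (g : MSPHS.State n → ℝ) = S.H)
    (u : ℝ → Fin m → ℝ) (x : ℝ → MSPHS.State n) (hx : S.IsTrajectory u x)
    (hxsmooth : ContDiffOn ℝ ((p + 1 : ℕ) : WithTop ℕ∞) x (Set.Ici 0))
    (hxbound : ∃ D : ℝ, ∀ t, 0 ≤ t → ‖iteratedDerivWithin (p + 1) x (Set.Ici 0) t‖ ≤ D)
    (σf : ℝ) (hσf : 0 < σf)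
    (hκ : ∃ κ : ℝ, ∀ t, 0 ≤ t →
      (MSPHS.phsKernel S (MSPHS.baseKernel 𝓗) σf (x t) (x t)).trace ≤ κ ^ 2)
    (meth : MSPHS.VLMM M) (hp : meth.HasOrder p)
    (hmax ω : ℝ) (σx2 : ℝ≥0) (reg₀ : ℝ) (hreg₀ : 0 < reg₀) :
    ∃ Cfit : ℝ, 0 < Cfit ∧ ∃ Cbias : ℝ, 0 < Cbias ∧
      ∀ (K : ℕ), M < K →
      ∀ {Ω : Type*} [MeasurableSpace Ω] (P : Measure Ω) [IsProbabilityMeasure P]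
        (t : Fin K → Ω → ℝ) (ε : Fin K × Fin n → Ω → ℝ),
        MSPHS.IsSample P hmax ω σx2 t ε →
      ∀ ν : Measure (MSPHS.State n),
        Integrable (fun z => (MSPHS.phsKernel S (MSPHS.baseKernel 𝓗) σf z z).trace) ν →
      ∃ cobs : ℝ, 0 < cobs ∧
        (0 < MSPHS.obsConst 𝓗 S P meth x t ν → cobs = MSPHS.obsConst 𝓗 S P meth x t ν) ∧
        ∀ η : ℝ, 0 < η → η ≤ 1 →
          ENNReal.ofReal (1 - η) ≤
            P {w | MSPHS.vNormSq ν
                (MSPHS.estimator S (MSPHS.phsKernel S (MSPHS.baseKernel 𝓗) σf) meth u x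
                  (reg₀ * ((K - M : ℕ) : ℝ) ^ (-(1 / 5 : ℝ)))
                  (fun i => t i w) (fun q => ε q w) - S.drift) ≤
              Cfit / cobs ^ 2 * Real.log (4 / η) * ((K - M : ℕ) : ℝ) ^ (-(1 / 5 : ℝ)) +
                Cbias / cobs ^ 2 * MSPHS.meanStepPow (M := M) P t (2 * p + 2)} := by
  obtain ⟨g₀, hg₀⟩ := hH
  obtain ⟨Cfit, hCfit, Cbias, hCbias, Cnorm, hCnorm, H⟩ :=
    MSPHS.exists_estimator_error_bound 𝓗 hk S hg₀ u x hx hxsmooth hxbound σf hσf hκ meth hp hmax ω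
      σx2 reg₀ hreg₀
  refine ⟨Cfit, hCfit, Cbias, hCbias, ?_⟩
  intro K hKM Ω _ P _ t ε hsample ν hν
  set θ : ℝ := ((K - M : ℕ) : ℝ) ^ (-(1 / 5 : ℝ)) with hθ
  have hθ0 : 0 < θ := by
    refine Real.rpow_pos_of_pos ?_ _
    have : 0 < K - M := by omega
    exact_mod_cast this
  have hmean : 0 ≤ MSPHS.meanStepPow (M := M) P t (2 * p + 2) :=
    div_nonneg (Finset.sum_nonneg fun k _ => integral_nonneg fun w =>
      Even.pow_nonneg ⟨p + 1, by ring⟩ _) (Nat.cast_nonneg _)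
  by_cases hobs : 0 < MSPHS.obsConst 𝓗 S P meth x t ν
  · refine ⟨_, hobs, fun _ => rfl, fun η hη hη1 => H K hKM P t ε hsample η hη hη1 _ ?_⟩
    intro w d hd hW _
    rw [Set.mem_ofPred_eq, hd, div_mul_eq_mul_div, div_mul_eq_mul_div, div_mul_eq_mul_div,
      ← add_div, le_div_iff₀ (by positivity), mul_comm]
    exact (MSPHS.obsConst_sq_mul_vNormSq_le hobs d).trans hW
  -- Without observability, integrating the pointwise bound `norm_field_sq_le` over `ν` controls the
  -- error by `‖d‖²` times the integrated trace.
  · set I : ℝ := ∫ z, (MSPHS.phsKernel S (MSPHS.baseKernel 𝓗) σf z z).trace ∂ν with hI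
    have hI0 : 0 ≤ I := integral_nonneg fun z => by
      rw [MSPHS.trace_phsKernel hk]
      exact mul_nonneg (sq_nonneg _) (Finset.sum_nonneg fun c _ => sq_nonneg _)
    set X : ℝ := Cnorm * I / σf ^ 2 + 1 with hX
    have hX0 : 0 < X := by positivity
    -- Chosen so that `Cfit / cobs² * θ = X / θ`, the size of the bound on `‖d‖²`; the nonnegative
    -- bias term is then simply added.
    have hc : 0 < θ * √(Cfit / X) := by positivity
    refine ⟨_, hc, fun h => absurd h hobs, fun η hη hη1 => H K hKM P t ε hsample η hη hη1 _ ?_⟩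
    intro w d hd _ hnorm
    have hΛ : 0 < Real.log (4 / η) :=
      zero_lt_one.trans_le (MSPHS.log_three_mul_div_le le_rfl hη hη1).1
    have hV : MSPHS.vNormSq ν (S.field (d : MSPHS.State n → ℝ)) ≤ ‖d‖ ^ 2 / σf ^ 2 * I := by
      rw [hI, ← integral_const_mul]
      exact integral_mono_of_nonneg (Filter.Eventually.of_forall fun z => sq_nonneg _)
        (hν.const_mul _) (Filter.Eventually.of_forall fun z => MSPHS.norm_field_sq_le hk S hσf d z)
    rw [Set.mem_ofPred_eq, hd]
    have hsq : (θ * √(Cfit / X)) ^ 2 = θ ^ 2 * (Cfit / X) := by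
      rw [mul_pow, Real.sq_sqrt (by positivity)]
    calc MSPHS.vNormSq ν (S.field (d : MSPHS.State n → ℝ)) ≤ ‖d‖ ^ 2 / σf ^ 2 * I := hV
      _ ≤ Cnorm * Real.log (4 / η) / θ / σf ^ 2 * I := by gcongr
      _ = (Cnorm * I / σf ^ 2) * (Real.log (4 / η) / θ) := by ring
      _ ≤ X * (Real.log (4 / η) / θ) := by gcongr; linarith
      _ = Cfit / (θ * √(Cfit / X)) ^ 2 * Real.log (4 / η) * θ := by rw [hsq]; field_simp
      _ ≤ _ := le_add_of_nonneg_right (mul_nonneg (by positivity) hmean)
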